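/- Let $f$ be a field of characteristic $0$ and let $V=f^2$ be the standard representation of $SL(2)=SL_2(f)$ with basis $(x,y)$, so that $\begin{pmatrix}a&b\\c&d\end{pmatrix}$ sends $x\mapsto ax+cy$, $y\mapsto bx+dy$. Let $\rho_k$ be the induced representation on $S^kV$, the space of homogeneous polynomials of degree $k$ in $x,y$. An outerplanar graph is a graph with vertices $0,1,\dots,m$ (points of the real axis), multiple edges allowed and loops not allowed, whose edges can be drawn in the closed upper half-plane $\{z\in\mathbb C:\Im z\ge 0\}$ without intersections (edges may meet only at common end vertices, and no edge passes through a vertex in its interior). Graphs are identified when they have the same number of edges between any two vertices. Let $\mathcal O(G)$ be the set of orientations of $G$, parallel edges being regarded as distinct and oriented independently. Let $G$ be outerplanar with vertex degrees $d_0,d_1,\dots,d_m$. For $g\in\mathcal O(G)$ let $d_k^{\rm out}(g)$ and $d_k^{\rm in}(g)$ be the numbers of arrows of $g$ beginning, respectively ending, in $k$, let $\mathrm{inv}\,g$ be the number of arrows $(k,l)$ of $g$ (from $k$ to $l$) with $k>l$, and put $$b_g=x^{d_1^{\rm out}(g)}y^{d_1^{\rm in}(g)}\otimes\dots\otimes x^{d_m^{\rm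 out}(g)}y^{d_m^{\rm in}(g)}\in S^{d_1}V\otimes\dots\otimes S^{d_m}V .$$ For an integer $0\le i\le d_0$ put $$t_{G,i}=\sum_{g\in\mathcal O(G),\ d_0^{\rm in}(g)=i}(-1)^{\mathrm{inv}\,g}\,b_g ,\qquad T_G=\mathrm{span}(t_{G,0},\dots,t_{G,d_0}).$$ **Theorem.** Let $m\ge 0$ and let $d_1,\dots,d_m\ge 0$ be integers. 1. For every integer $d_0\ge 0$, the tensors $t_{G,i}$, parametrized by all outerplanar graphs $G$ with degrees $d_0,d_1,\dots,d_m$ and all integers $0\le i\le d_0$, form a basis of the isotypic component of type $\rho_{d_0}$ of $\rho_{d_1}\otimes\dots\otimes\rho_{d_m}$. 2. For every outerplanar graph $G$ with degrees $d_0,d_1,\dots,d_m$ ($d_0$ arbitrary), $(t_{G,0},\dots,t_{G,d_0})$ is a basis of $T_G$, the subspace $T_G$ is $SL(2)$-invariant, and the linear map $$s_G:S^{d_0}V\to T_G,\qquad x^iy^{d_0-i}\mapsto\frac{(-1)^i}{\binom{d_0}{i}}\,t_{G,i}\quad(0\le i\le d_0)$$ is an isomorphism of representations from $\rho_{d_0}$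 onto the subrepresentation $T_G$. 3. $$S^{d_1}V\otimes\dots\otimes S^{d_m}V=\bigoplus_G T_G ,$$ where the direct sum is over all outerplanar graphs $G$ whose vertices $1,\dots,m$ have degrees $d_1,\dots,d_m$, with all possible values of the degree $d_0$ of the vertex $0$. -/

import Mathlib

open scoped TensorProduct

noncomputable section

namespace OuterplanarTensor

/-! ### The irreducible representations of `SL(2)` and their tensor products -/

/-- The linear change of variables `x ↦ a x + c y`, `y ↦ b x + d y` in `f[x, y]` given by the
matrix `(a b; c d)`, where `x = X 0` and `y = X 1`. -/
def changeVars {f : Type*} [Field f] (g : Matrix (Fin 2) (Fin 2) f) :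
    MvPolynomial (Fin 2) f →ₐ[f] MvPolynomial (Fin 2) f :=
  MvPolynomial.aeval fun j => ∑ i, MvPolynomial.C (g i j) * MvPolynomial.X i

theorem changeVars_one {f : Type*} [Field f] :
    changeVars (1 : Matrix (Fin 2) (Fin 2) f) = AlgHom.id f _ := by
  apply MvPolynomial.algHom_ext
  intro j
  fin_cases j <;> simp [changeVars, Matrix.one_apply]

theorem changeVars_mul {f : Type*} [Field f] (g h : Matrix (Fin 2) (Fin 2) f) :
    changeVars (g * h) = (changeVars g).comp (changeVars h) := by
  apply MvPolynomial.algHom_ext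
  intro j
  simp only [changeVars, AlgHom.comp_apply, MvPolynomial.aeval_X, Fin.sum_univ_two,
    Matrix.mul_apply, map_add, map_mul, MvPolynomial.algHom_C, MvPolynomial.algebraMap_eq]
  ring

theorem changeVars_mem {f : Type*} [Field f] (g : Matrix (Fin 2) (Fin 2) f) (k : ℕ)
    (p : MvPolynomial (Fin 2) f) (hp : p ∈ MvPolynomial.homogeneousSubmodule (Fin 2) f k) :
    changeVars g p ∈ MvPolynomial.homogeneousSubmodule (Fin 2) f k := by
  rw [MvPolynomial.mem_homogeneousSubmodule] at hp ⊢
  have h := hp.aeval (fun j => ∑ i, MvPolynomial.C (g i j) * MvPolynomial.X i) (n := 1)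
    (fun j => MvPolynomial.IsHomogeneous.sum _ _ _ fun i _ => by
      simpa using (MvPolynomial.isHomogeneous_C (Fin 2) (g i j)).mul
        (MvPolynomial.isHomogeneous_X f i))
  simpa [changeVars] using h

/-- `S^k V` for the standard two-dimensional space `V` with basis `(x, y)`: the homogeneous
polynomials of degree `k` in `x = X 0` and `y = X 1`. -/
abbrev SymPow (f : Type*) [Field f] (k : ℕ) : Type _ :=
  MvPolynomial.homogeneousSubmodule (Fin 2) f k

/-- The representation `ρ_k` of `SL(2)` on `S^k V` by linear changes of variables. -/
def rho (f : Type*) [Field f] (k : ℕ) :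
    Representation f (Matrix.SpecialLinearGroup (Fin 2) f) (SymPow f k) where
  toFun g := (changeVars (g : Matrix (Fin 2) (Fin 2) f)).toLinearMap.restrict
    (changeVars_mem (g : Matrix (Fin 2) (Fin 2) f) k)
  map_one' := by
    ext p : 2
    simp [LinearMap.restrict_apply, changeVars_one]
  map_mul' g h := by
    ext p : 2
    simp only [Matrix.SpecialLinearGroup.coe_mul, changeVars_mul]
    rfl

/-- The monomial `x^a y^b` as an element of `S^k V`, where `a + b = k`. -/
def xy (f : Type*) [Field f] {k : ℕ} (a b : ℕ) (h : a + b = k) : SymPow f k :=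
  ⟨MvPolynomial.X 0 ^ a * MvPolynomial.X 1 ^ b, by
    rw [MvPolynomial.mem_homogeneousSubmodule, ← h]
    exact (MvPolynomial.isHomogeneous_X_pow 0 a).mul (MvPolynomial.isHomogeneous_X_pow 1 b)⟩

/-- The space `S^{d_1} V ⊗ … ⊗ S^{d_m} V`; the factor with index `k : Fin m` is the `(k+1)`-st
one, of degree `d k`. -/
abbrev TensorSpace (f : Type*) [Field f] {m : ℕ} (d : Fin m → ℕ) : Type _ :=
  ⨂[f] k, SymPow f (d k)

/-- The representation `ρ_{d_1} ⊗ … ⊗ ρ_{d_m}`. -/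
def rhoTensor (f : Type*) [Field f] {m : ℕ} (d : Fin m → ℕ) :
    Representation f (Matrix.SpecialLinearGroup (Fin 2) f) (TensorSpace f d) where
  toFun g := PiTensorProduct.map fun k => rho f (d k) g
  map_one' := by simp only [map_one, PiTensorProduct.map_one]
  map_mul' g h := by simp only [map_mul, PiTensorProduct.map_mul]

/-- The isotypic component of type `ρ_{d₀}` in `ρ_{d_1} ⊗ … ⊗ ρ_{d_m}`: the sum of all
subrepresentations isomorphic to `ρ_{d₀}`. -/
def isotypic (f : Type*) [Field f] {m : ℕ} (d : Fin m → ℕ) (d₀ : ℕ) :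
    Submodule f (TensorSpace f d) :=
  ⨆ U : {U : Subrepresentation (rhoTensor f d) //
    Nonempty ((rho f d₀).Equiv U.toRepresentation)}, U.1.toSubmodule

/-! ### Outerplanar graphs -/

/-- A graph with the vertices `0, 1, …, m`, without loops but possibly with multiple edges, given
by the number `mult s(k, l)` of edges between `k` and `l`. -/
@[ext]
structure Multigraph (m : ℕ) where
  mult : Sym2 (Fin (m + 1)) → ℕ
  loopless : ∀ k, mult s(k, k) = 0

namespace Multigraph

variable {m : ℕ} (G : Multigraph m)

/-- The edges of `G`: a pair of ends, and a label telling parallel edges apart. -/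
abbrev Edge : Type := Σ e : Sym2 (Fin (m + 1)), Fin (G.mult e)

/-- The degree of the vertex `k`: the number of edges with end `k`. -/
def degree (k : Fin (m + 1)) : ℕ :=
  (Finset.univ.filter fun e : G.Edge => k ∈ e.1).card

/-- `G` is outerplanar if its edges can be drawn in the closed upper half-plane without
intersections: there are simple arcs `γ e`, one for each edge `e`, that lie in the closed upper
half-plane and join the ends of `e`, such that the interior of an arc contains no vertex and meets
no other arc. The vertex `k` is the point `k` of the real axis. -/
def IsOuterplanar : Prop :=
  ∃ γ : G.Edge → unitInterval → ℂ,
    (∀ e, Continuous (γ e) ∧ Function.Injective (γ e)) ∧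
    (∀ e s, 0 ≤ (γ e s).im) ∧
    (∀ e, s(γ e 0, γ e 1) = e.1.map fun k : Fin (m + 1) => ((k : ℕ) : ℂ)) ∧
    (∀ e s, s ≠ 0 → s ≠ 1 → ∀ k : Fin (m + 1), γ e s ≠ ((k : ℕ) : ℂ)) ∧
    (∀ e e', e ≠ e' → ∀ s s', s ≠ 0 → s ≠ 1 → γ e s ≠ γ e' s')

/-- The set of directed graphs with underlying undirected graph `G`: each edge `e` becomes an
arrow from `(g.1 e).1` to `(g.1 e).2`. -/
abbrev Orientation : Type :=
  {g : G.Edge → Fin (m + 1) × Fin (m + 1) // ∀ e, s((g e).1, (g e).2) = e.1}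

variable {G}

/-- The number of arrows of `g` beginning in `k`. -/
def outDeg (g : G.Orientation) (k : Fin (m + 1)) : ℕ :=
  (Finset.univ.filter fun e : G.Edge => (g.1 e).1 = k).card

/-- The number of arrows of `g` ending in `k`. -/
def inDeg (g : G.Orientation) (k : Fin (m + 1)) : ℕ :=
  (Finset.univ.filter fun e : G.Edge => (g.1 e).2 = k).card

/-- The number of inversions of `g`, i.e. of arrows `(k, l)` with `k > l`. -/
def inv (g : G.Orientation) : ℕ :=
  (Finset.univ.filter fun e : G.Edge => (g.1 e).2 < (g.1 e).1).card

theorem outDeg_add_inDeg (g : G.Orientation) (k : Fin (m + 1)) :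
    outDeg g k + inDeg g k = G.degree k := by
  unfold outDeg inDeg degree
  rw [← Finset.card_union_of_disjoint]
  · congr 1
    ext e
    simp only [Finset.mem_union, Finset.mem_filter, Finset.mem_univ, true_and]
    rw [← g.2 e, Sym2.mem_iff]
    tauto
  · rw [Finset.disjoint_filter]
    intro e _ h1 h2
    have h3 : e.1 = s(k, k) := by rw [← g.2 e, h1, h2]
    have h4 : G.mult e.1 = 0 := by rw [h3, G.loopless k]
    exact absurd e.2.2 (by omega)

end Multigraph

/-- The outerplanar graphs on `0, 1, …, m` whose vertices `1, …, m` have the degrees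
`d_1, …, d_m`; the degree of the vertex `0` is arbitrary. -/
def OuterplanarGraph {m : ℕ} (d : Fin m → ℕ) : Type :=
  {G : Multigraph m // G.IsOuterplanar ∧ ∀ k : Fin m, G.degree k.succ = d k}

namespace OuterplanarGraph

variable {m : ℕ} {d : Fin m → ℕ}

instance : DecidableEq (OuterplanarGraph d) := Classical.decEq _

/-- The degree `d₀` of the vertex `0`. -/
def deg0 (G : OuterplanarGraph d) : ℕ := G.1.degree 0

/-- The tensor `b_g = x_1(g) ⊗ … ⊗ x_m(g)`, where `x_k(g)` is `x` to the number of arrows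
beginning in `k` times `y` to the number of arrows ending in `k`. -/
def b (f : Type*) [Field f] (G : OuterplanarGraph d) (g : G.1.Orientation) : TensorSpace f d :=
  PiTensorProduct.tprod f fun k : Fin m =>
    xy f (Multigraph.outDeg g k.succ) (Multigraph.inDeg g k.succ)
      ((Multigraph.outDeg_add_inDeg g k.succ).trans (G.2.2 k))

/-- The tensor `t_{G,i}`: the sum of `(-1)^{inv g} b_g` over the orientations `g` of `G` with
exactly `i` arrows ending in the vertex `0`. -/
def t (f : Type*) [Field f] (G : OuterplanarGraph d) (i : ℕ) : TensorSpace f d :=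
  ∑ g : G.1.Orientation with Multigraph.inDeg g 0 = i,
    (-1 : f) ^ Multigraph.inv g • G.b f g

/-- The span `T_G` of `t_{G,0}, …, t_{G,d₀}`. -/
def T (f : Type*) [Field f] (G : OuterplanarGraph d) : Submodule f (TensorSpace f d) :=
  Submodule.span f (Set.range fun i : Fin (G.deg0 + 1) => G.t f i)

end OuterplanarGraph

end OuterplanarTensor

end

open OuterplanarTensor

/-!
Attach to the graph `G` the polynomial `P_G = ∏ (x_k y_l - x_l y_k)`, the product being over all
edges `{k, l}` with `k < l`. Expanding it over the orientations of `G` shows that `t_{G,i}` is its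
coefficient at `x_0^(d₀-i) y_0^i`, once the tensor product is embedded into the polynomials in the
variables `x_k, y_k` (`toPoly`). Substituting `x_0 = β`, `y_0 = -α` turns the factors of the edges
at `0` into `α x_k + β y_k` and leaves the other factors, which are `SL(2)`-invariant, unchanged.
The substituted polynomial is the image of `(α x + β y)^{d₀}` under `s_G` (`sMap_linPow`). As the
powers of linear forms span `S^{d₀} V` in characteristic zero (`span_linPow_eq_top`), `s_G` is
equivariant (`rhoTensor_sMap`).

Outerplanarity is equivalent to the absence of edges `{i, j}`, `{k, l}` with `i < k < j < l`. Such
edges cannot be drawn disjointly, because two curves in the closed half-plane with interleaved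
ends on its boundary meet (`exists_eq_of_interleaved`); non-crossing edges can be drawn as
parabolic arcs.

Linear independence is first shown for the highest weight vectors `t_{G,0}`. Orienting all edges
of `G` to the right gives a leading monomial of `t_{G,0}`, and a non-crossing graph is determined
by the numbers of edges going right and left from its vertices `1, …, m`
(`IsNonCrossing.eq_of_rightDeg_eq`), hence by this monomial. The unipotent elements `x ↦ x + τ y`
carry `t_{G,i}` to a polynomial in `τ` of degree `i` whose leading coefficient is a nonzero
multiple of `t_{G,0}`; this propagates linear independence to all `t_{G,i}`, and it also shows
that a vector fixed by these elements is a combination of the `t_{G,0}`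
(`deg_eq_zero_of_unipotent_fixed`).

The `t_{G,i}` span because there are enough of them: reading the letters `x` and `y` of a monomial
as opening and closing brackets, joining matching brackets by an edge and unmatched ones to `0`,
one obtains a different pair `(G, i)` from every monomial (`exists_hasWord`,
`HasWord.eq_of_sum_eq`).

Finally, an equivariant map from `S^{d₀} V` to the tensor product carries `y^{d₀}` to a vector
fixed by the `x ↦ x + τ y` and of weight `d₀`, hence into the span of the `t_{G,0}` with `d₀`
edges at `0` (`map_linPow_mem_span`). As the translates of `y^{d₀}` span, this gives the isotypic
components.
-/

noncomputable section

namespace OuterplanarTensor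

/-! ### Outerplanar graphs are the non-crossing graphs -/

/-- A continuous angle whose sine stays nonnegative stays within one half-turn. -/
theorem exists_half_turn {X : Type*} [TopologicalSpace X] [PreconnectedSpace X] [Nonempty X]
    {θ : X → ℝ} (hθ : Continuous θ) (h : ∀ u, 0 ≤ Real.sin (θ u)) :
    ∃ k : ℤ, ∀ u, 2 * k * Real.pi ≤ θ u ∧ θ u ≤ (2 * k + 1) * Real.pi := by
  obtain ⟨u₀⟩ := ‹Nonempty X›
  have hpi := Real.pi_pos
  set k : ℤ := ⌊θ u₀ / (2 * Real.pi)⌋ with hk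
  have h1 : (k : ℝ) * (2 * Real.pi) ≤ θ u₀ := by
    rw [← le_div_iff₀ (by positivity)]; exact Int.floor_le _
  have h2 : θ u₀ < ((k : ℝ) + 1) * (2 * Real.pi) := by
    rw [← div_lt_iff₀ (by positivity)]; exact Int.lt_floor_add_one _
  have hsin : ∀ u, 0 ≤ Real.sin (θ u - k * (2 * Real.pi)) := fun u => by
    rw [Real.sin_sub_int_mul_two_pi]; exact h u
  have h3 : θ u₀ - k * (2 * Real.pi) ≤ Real.pi := by
    by_contra! hc
    have := Real.sin_neg_of_neg_of_neg_pi_lt (x := θ u₀ - k * (2 * Real.pi) - 2 * Real.pi)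
      (by linarith) (by linarith)
    rw [Real.sin_sub_two_pi] at this
    linarith [hsin u₀]
  refine ⟨k, fun u => ⟨?_, ?_⟩⟩
  · by_contra! hc
    obtain ⟨v, hv⟩ := mem_range_of_exists_le_of_exists_ge (f := θ)
      (c := max (θ u) (k * (2 * Real.pi) - Real.pi / 2)) hθ ⟨u, le_max_left _ _⟩
      ⟨u₀, max_le (by linarith) (by linarith)⟩
    have := Real.sin_neg_of_neg_of_neg_pi_lt (x := θ v - k * (2 * Real.pi))
      (by rw [hv, sub_neg, max_lt_iff]; constructor <;> linarith)
      (by rw [hv]; linarith [le_max_right (θ u) (k * (2 * Real.pi) - Real.pi / 2)])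
    linarith [hsin v]
  · by_contra! hc
    obtain ⟨v, hv⟩ := mem_range_of_exists_le_of_exists_ge (f := θ)
      (c := min (θ u) (k * (2 * Real.pi) + 3 * Real.pi / 2)) hθ
      ⟨u₀, le_min (by linarith) (by linarith)⟩ ⟨u, min_le_left _ _⟩
    have := Real.sin_neg_of_neg_of_neg_pi_lt (x := θ v - k * (2 * Real.pi) - 2 * Real.pi)
      (by rw [hv]; linarith [min_le_right (θ u) (k * (2 * Real.pi) + 3 * Real.pi / 2)])
      (by
        have : k * (2 * Real.pi) + Real.pi < θ v := by
          rw [hv, lt_min_iff]; constructor <;> linarith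
        linarith)
    rw [Real.sin_sub_two_pi] at this
    linarith [hsin v]

theorem exists_half_turn_of_nonpos {X : Type*} [TopologicalSpace X] [PreconnectedSpace X]
    [Nonempty X] {θ : X → ℝ} (hθ : Continuous θ) (h : ∀ u, Real.sin (θ u) ≤ 0) :
    ∃ k : ℤ, ∀ u, (2 * k - 1) * Real.pi ≤ θ u ∧ θ u ≤ 2 * k * Real.pi := by
  obtain ⟨k, hk⟩ := exists_half_turn (θ := fun u => θ u + Real.pi) (by fun_prop)
    (fun u => by rw [Real.sin_add_pi]; linarith [h u])
  refine ⟨k, fun u => ?_⟩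
  have := hk u
  constructor <;> linarith

/-- The argument of a negative real number is an odd multiple of `π`. -/
theorem im_eq_of_exp_eq_neg {z : ℂ} {r : ℝ} (h : Complex.exp z = r) (hr : r < 0) :
    ∃ k : ℤ, z.im = (2 * k + 1) * Real.pi := by
  have hs : Real.sin z.im = 0 := by
    have := congrArg Complex.im h
    rw [Complex.exp_im, Complex.ofReal_im] at this
    simpa [Real.exp_ne_zero] using this
  have hc : Real.cos z.im < 0 := by
    have := congrArg Complex.re h
    rw [Complex.exp_re, Complex.ofReal_re] at this
    by_contra! hc
    have := mul_nonneg (Real.exp_pos z.re).le hc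
    linarith
  have hc1 : Real.cos z.im = -1 := by
    rcases Real.sin_eq_zero_iff_cos_eq.1 hs with h | h
    · linarith
    · exact h
  obtain ⟨k, hk⟩ := Real.cos_eq_neg_one_iff.1 hc1
  exact ⟨k, by linarith⟩

theorem im_eq_of_exp_eq_pos {z : ℂ} {r : ℝ} (h : Complex.exp z = r) (hr : 0 < r) :
    ∃ k : ℤ, z.im = 2 * k * Real.pi := by
  obtain ⟨k, hk⟩ := im_eq_of_exp_eq_neg (z := z + Real.pi * Complex.I) (r := -r)
    (by rw [Complex.exp_add, h, Complex.exp_pi_mul_I]; simp) (by linarith)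
  refine ⟨k, ?_⟩
  simp at hk
  linarith

/-- Two curves in the closed upper half-plane whose end points on the real axis interleave
meet: otherwise `α s - β t` has a continuous logarithm on the square, but its argument changes
by `2π` along the boundary. -/
theorem exists_eq_of_interleaved {α β : unitInterval → ℂ} (hα : Continuous α) (hβ : Continuous β)
    (hα0 : ∀ s, 0 ≤ (α s).im) (hβ0 : ∀ s, 0 ≤ (β s).im) {a b c d : ℝ} (hab : a < b) (hbc : b < c)
    (hcd : c < d) (ha : α 0 = a) (hc : α 1 = c) (hb : β 0 = b) (hd : β 1 = d) :
    ∃ s t, α s = β t := by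
  by_contra! hne
  have := hab.trans hbc
  obtain ⟨F, ⟨-, hF⟩, -⟩ := Complex.isCoveringMapOn_exp.existsUnique_continuousMap_lifts
    (A := ℝ × ℝ)
    ⟨fun p => α (Set.projIcc 0 1 zero_le_one p.1) - β (Set.projIcc 0 1 zero_le_one p.2),
      by fun_prop⟩
    (a₀ := (0, 0)) (Complex.exp_log (sub_ne_zero.2 (hne _ _)))
    (fun p => sub_ne_zero.2 (hne _ _))
  have hθ : Continuous fun p : unitInterval × unitInterval => (F (p.1, p.2)).im := by fun_prop
  set θ : unitInterval → unitInterval → ℝ := fun s t => (F (s, t)).im with hθdef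
  have hexp : ∀ s t : unitInterval, Complex.exp (F (s, t)) = α s - β t := fun s t => by
    have := congrFun hF (s, t)
    simpa using this
  have hsin : ∀ s t : unitInterval, Real.exp (F (s, t)).re * Real.sin (θ s t) =
      (α s).im - (β t).im := fun s t => by
    rw [← Complex.sub_im, ← hexp, Complex.exp_im]
  have hpos : ∀ s t, (β t).im = 0 → 0 ≤ Real.sin (θ s t) := fun s t h => by
    have h1 := hsin s t
    rw [h, sub_zero] at h1
    exact nonneg_of_mul_nonneg_right (h1.symm ▸ hα0 s) (Real.exp_pos _)
  have hneg : ∀ s t, (α s).im = 0 → Real.sin (θ s t) ≤ 0 := fun s t h => by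
    have h1 := hsin s t
    rw [h, zero_sub] at h1
    by_contra! h2
    have := mul_pos (Real.exp_pos (F (s, t)).re) h2
    linarith [hβ0 t]
  -- At the corners `α s - β t` is real, of known sign, so its argument is a known multiple of `π`
  -- up to `2π`; along each side it moves within one half-turn.
  obtain ⟨k1, h00⟩ := im_eq_of_exp_eq_neg (z := F ((0 : unitInterval), (0 : unitInterval)))
    (r := a - b) (by rw [hexp, ha, hb]; simp) (by linarith)
  obtain ⟨k2, h01⟩ := im_eq_of_exp_eq_neg (z := F ((0 : unitInterval), (1 : unitInterval)))
    (r := a - d) (by rw [hexp, ha, hd]; simp) (by linarith)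
  obtain ⟨k3, h11⟩ := im_eq_of_exp_eq_neg (z := F ((1 : unitInterval), (1 : unitInterval)))
    (r := c - d) (by rw [hexp, hc, hd]; simp) (by linarith)
  obtain ⟨k4, h10⟩ := im_eq_of_exp_eq_pos (z := F ((1 : unitInterval), (0 : unitInterval)))
    (r := c - b) (by rw [hexp, hc, hb]; simp) (by linarith)
  obtain ⟨n1, e1⟩ := exists_half_turn_of_nonpos (θ := fun t => θ 0 t) (by fun_prop)
    (fun t => hneg 0 t (by simp [ha]))
  obtain ⟨n2, e2⟩ := exists_half_turn (θ := fun s => θ s 1) (by fun_prop)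
    (fun s => hpos s 1 (by simp [hd]))
  obtain ⟨n3, e3⟩ := exists_half_turn_of_nonpos (θ := fun t => θ 1 t) (by fun_prop)
    (fun t => hneg 1 t (by simp [hc]))
  obtain ⟨n4, e4⟩ := exists_half_turn (θ := fun s => θ s 0) (by fun_prop)
    (fun s => hpos s 0 (by simp [hb]))
  have hpi := Real.pi_pos
  have key : ∀ {x y : ℤ}, (x : ℝ) * Real.pi ≤ y * Real.pi → x ≤ y := fun {x y} h => by
    exact_mod_cast le_of_mul_le_mul_right h hpi
  have conv_neg : ∀ {n k : ℤ} {x : ℝ}, x = (2 * k + 1) * Real.pi →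
      (2 * n - 1) * Real.pi ≤ x ∧ x ≤ 2 * n * Real.pi → 2 * n - 1 ≤ 2 * k + 1 ∧ 2 * k + 1 ≤ 2 * n :=
    fun {n k x} hx h => ⟨key (by push_cast; linarith), key (by push_cast; linarith)⟩
  have conv_pos : ∀ {n k : ℤ} {x : ℝ}, x = (2 * k + 1) * Real.pi →
      2 * n * Real.pi ≤ x ∧ x ≤ (2 * n + 1) * Real.pi → 2 * n ≤ 2 * k + 1 ∧ 2 * k + 1 ≤ 2 * n + 1 :=
    fun {n k x} hx h => ⟨key (by push_cast; linarith), key (by push_cast; linarith)⟩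
  have a1 := conv_neg h00 (e1 0)
  have a2 := conv_neg h01 (e1 1)
  have a3 := conv_pos h01 (e2 0)
  have a4 := conv_pos h11 (e2 1)
  have a5 := conv_neg h11 (e3 1)
  have a6 : 2 * n3 - 1 ≤ 2 * k4 ∧ 2 * k4 ≤ 2 * n3 :=
    ⟨key (by push_cast; linarith [(e3 0).1]), key (by push_cast; linarith [(e3 0).2])⟩
  have a7 : 2 * n4 ≤ 2 * k4 ∧ 2 * k4 ≤ 2 * n4 + 1 :=
    ⟨key (by push_cast; linarith [(e4 1).1]), key (by push_cast; linarith [(e4 1).2])⟩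
  have a8 := conv_pos h00 (e4 0)
  omega

namespace Multigraph

variable {m : ℕ} {G : Multigraph m}

/-- No two edges of `G` have interleaved ends. -/
def IsNonCrossing (G : Multigraph m) : Prop :=
  ∀ i k j l, i < k → k < j → j < l → G.mult s(i, j) = 0 ∨ G.mult s(k, l) = 0

theorem IsOuterplanar.isNonCrossing (h : G.IsOuterplanar) : G.IsNonCrossing := by
  obtain ⟨γ, hγ, him, hends, hvert, hdisj⟩ := h
  -- Each arc can be traversed from its left end to its right end.
  have hord : ∀ (e : G.Edge) (i j : Fin (m + 1)), e.1 = s(i, j) → ∃ α : unitInterval → ℂ,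
      Continuous α ∧ (∀ s, 0 ≤ (α s).im) ∧ α 0 = ((i : ℕ) : ℝ) ∧ α 1 = ((j : ℕ) : ℝ) ∧
        ∀ s, ∃ s', α s = γ e s' := by
    intro e i j he
    have h1 := hends e
    rw [he, Sym2.map_mk, Sym2.eq_iff] at h1
    rcases h1 with ⟨h0, h1⟩ | ⟨h0, h1⟩
    · exact ⟨γ e, (hγ e).1, him e, by simp [h0], by simp [h1], fun s => ⟨s, rfl⟩⟩
    · exact ⟨fun s => γ e (unitInterval.symm s), (hγ e).1.comp unitInterval.continuous_symm,
        fun s => him e _, by simp [h1], by simp [h0], fun s => ⟨_, rfl⟩⟩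
  intro i k j l hik hkj hjl
  by_contra! hne
  let e : G.Edge := ⟨s(i, j), ⟨0, Nat.pos_of_ne_zero hne.1⟩⟩
  let e' : G.Edge := ⟨s(k, l), ⟨0, Nat.pos_of_ne_zero hne.2⟩⟩
  have hee : e ≠ e' := fun h => by
    have h1 : s(i, j) = s(k, l) := congrArg Sigma.fst h
    rw [Sym2.eq_iff] at h1
    rcases h1 with ⟨h, -⟩ | ⟨h, -⟩
    · exact hik.ne h
    · exact (hik.trans (hkj.trans hjl)).ne h
  obtain ⟨α, ca, ia, a0, a1, ra⟩ := hord e i j rfl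
  obtain ⟨β, cb, ib, b0, b1, rb⟩ := hord e' k l rfl
  obtain ⟨s, t, hst⟩ := exists_eq_of_interleaved ca cb ia ib
    (by exact_mod_cast hik) (by exact_mod_cast hkj) (by exact_mod_cast hjl) a0 a1 b0 b1
  obtain ⟨s', hs⟩ := ra s
  obtain ⟨t', ht⟩ := rb t
  have heq : γ e s' = γ e' t' := by rw [← hs, ← ht, hst]
  by_cases h1 : s' ≠ 0 ∧ s' ≠ 1
  · exact hdisj e e' hee s' t' h1.1 h1.2 heq
  by_cases h2 : t' ≠ 0 ∧ t' ≠ 1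
  · exact hdisj e' e hee.symm t' s' h2.1 h2.2 heq.symm
  -- Both points are end points of their arcs, hence vertices, but the four vertices differ.
  have m1 : γ e s' ∈ s(γ e 0, γ e 1) := by
    rw [Sym2.mem_iff]
    by_cases h : s' = 0
    · simp [h]
    · right; congr 1; tauto
  have m2 : γ e' t' ∈ s(γ e' 0, γ e' 1) := by
    rw [Sym2.mem_iff]
    by_cases h : t' = 0
    · simp [h]
    · right; congr 1; tauto
  rw [hends, Sym2.mem_map] at m1 m2
  obtain ⟨p, hp, hp'⟩ := m1
  obtain ⟨q, hq, hq'⟩ := m2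
  have hpq : p = q := by
    have : ((p : ℕ) : ℂ) = ((q : ℕ) : ℂ) := by rw [hp', hq', heq]
    exact Fin.ext (by exact_mod_cast this)
  subst hpq
  have hp1 : p = i ∨ p = j := Sym2.mem_iff.1 hp
  have hq1 : p = k ∨ p = l := Sym2.mem_iff.1 hq
  omega

theorem Edge.inf_lt_sup (e : G.Edge) : e.1.inf < e.1.sup := by
  obtain ⟨e, p, hp⟩ := e
  induction e with
  | _ a b =>
    have hab : a ≠ b := by
      rintro rfl
      rw [G.loopless] at hp
      omega
    exact _root_.inf_lt_sup.2 hab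

theorem Edge.eq_mk (e : G.Edge) : e.1 = s(e.1.inf, e.1.sup) := by
  obtain ⟨e, p⟩ := e
  induction e with
  | _ a b =>
    rcases le_total a b with h | h <;> simp [h, Sym2.eq_swap]

theorem Edge.mult_ne_zero (e : G.Edge) : G.mult e.1 ≠ 0 := by
  have := e.2.2
  omega

/-- A non-crossing graph is drawn with parabolic arcs `y = c (x - k) (l - x)`, where the
factor `c` grows with the length of the edge and, among parallel edges, with the label. -/
theorem IsNonCrossing.isOuterplanar (h : G.IsNonCrossing) : G.IsOuterplanar := by
  let W : ℕ := ∑ e, G.mult e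
  let P : G.Edge → ℝ := fun e => ((e.1.inf : ℕ) : ℝ)
  let Q : G.Edge → ℝ := fun e => ((e.1.sup : ℕ) : ℝ)
  let c : G.Edge → ℝ := fun e => W * (Q e - P e) + (e.2 : ℕ) + 1
  let xx : G.Edge → unitInterval → ℝ := fun e s => P e + (Q e - P e) * s
  have hPQ : ∀ e, P e < Q e := fun e => by
    have := Edge.inf_lt_sup e
    simp only [P, Q]
    exact_mod_cast this
  have hc : ∀ e, 0 < c e := fun e => by
    have := sub_pos.2 (hPQ e)
    simp only [c]
    positivity
  have hmem : ∀ e s, P e ≤ xx e s ∧ xx e s ≤ Q e := fun e s => by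
    have h1 := s.2.1
    have h2 := s.2.2
    have h3 := sub_pos.2 (hPQ e)
    simp only [xx]
    constructor <;> nlinarith
  have hmem' : ∀ e s, s ≠ 0 → s ≠ 1 → P e < xx e s ∧ xx e s < Q e := fun e s h0 h1 => by
    have h1 : (0 : ℝ) < s := unitInterval.pos_iff_ne_zero.2 h0
    have h2 : (s : ℝ) < 1 := unitInterval.lt_one_iff_ne_one.2 ‹_›
    have h3 := sub_pos.2 (hPQ e)
    simp only [xx]
    constructor <;> nlinarith
  -- A shorter edge below a longer one has the smaller factor.
  have hlt : ∀ e e' : G.Edge, Q e - P e + 1 ≤ Q e' - P e' → c e < c e' := fun e e' hl => by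
    have h1 : ((e.2 : ℕ) : ℝ) < W := by
      have h2 := e.2.2
      have h3 : G.mult e.1 ≤ W := Finset.single_le_sum (f := G.mult) (fun _ _ => Nat.zero_le _)
        (Finset.mem_univ _)
      exact_mod_cast h2.trans_le h3
    have h2 : (W : ℝ) * (Q e - P e + 1) ≤ W * (Q e' - P e') := by gcongr
    simp only [c]
    have : (0 : ℝ) ≤ (e'.2 : ℕ) := by positivity
    linarith
  have hnest : ∀ (e e' : G.Edge) (x : ℝ), P e < x → x < Q e → P e' ≤ P e → Q e ≤ Q e' →
      Q e - P e + 1 ≤ Q e' - P e' →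
      c e * ((x - P e) * (Q e - x)) < c e' * ((x - P e') * (Q e' - x)) := by
    intro e e' x h1 h2 h3 h4 h5
    have h6 : 0 < (x - P e) * (Q e - x) := mul_pos (by linarith) (by linarith)
    have h7 : (x - P e) * (Q e - x) ≤ (x - P e') * (Q e' - x) := by
      apply mul_le_mul <;> linarith
    calc _ < c e' * ((x - P e) * (Q e - x)) := mul_lt_mul_of_pos_right (hlt e e' h5) h6
      _ ≤ _ := mul_le_mul_of_nonneg_left h7 (hc e').le
  refine ⟨fun e s => ⟨xx e s, c e * ((xx e s - P e) * (Q e - xx e s))⟩, ?_, ?_, ?_, ?_, ?_⟩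
  · intro e
    constructor
    · have : Continuous (xx e) := by simp only [xx]; fun_prop
      have h2 : Continuous fun s => ((xx e s : ℝ) : ℂ) +
          ((c e * ((xx e s - P e) * (Q e - xx e s)) : ℝ) : ℂ) * Complex.I := by fun_prop
      convert h2 using 2
      exact Complex.mk_eq_add_mul_I _ _
    · intro s t hst
      have h1 : xx e s = xx e t := congrArg Complex.re hst
      have h2 := sub_pos.2 (hPQ e)
      exact Subtype.ext (mul_left_cancel₀ h2.ne' (add_left_cancel h1))
  · intro e s
    have := hmem e s
    exact mul_nonneg (hc e).le (mul_nonneg (by linarith) (by linarith))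
  · intro e
    rw [Edge.eq_mk e, Sym2.map_mk]
    congr 1 <;> simp [xx, P, Q, Complex.ext_iff]
  · intro e s h0 h1 k hk
    have := hmem' e s h0 h1
    have h2 := congrArg Complex.im hk
    rw [Complex.natCast_im] at h2
    exact (mul_pos (hc e) (mul_pos (by linarith) (by linarith))).ne' h2
  · intro e e' hne s s' h0 h1 heq
    obtain ⟨m1, m2⟩ := hmem' e s h0 h1
    obtain ⟨m3, m4⟩ := hmem e' s'
    have hx : xx e s = xx e' s' := congrArg Complex.re heq
    have hy : c e * ((xx e s - P e) * (Q e - xx e s)) =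
        c e' * ((xx e' s' - P e') * (Q e' - xx e' s')) := congrArg Complex.im heq
    rw [← hx] at hy m3 m4
    generalize xx e s = x at *
    have hpos : 0 < c e * ((x - P e) * (Q e - x)) :=
      mul_pos (hc e) (mul_pos (by linarith) (by linarith))
    have hpos' : 0 < (x - P e') * (Q e' - x) := by
      rw [hy] at hpos
      exact pos_of_mul_pos_right hpos (hc e').le
    have m3' : P e' < x := lt_of_le_of_ne m3 fun h => by simp [h] at hpos'
    have m4' : x < Q e' := lt_of_le_of_ne m4 fun h => by simp [h] at hpos'
    have i1 : e.1.inf < e'.1.sup := by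
      have : ((e.1.inf : ℕ) : ℝ) < (e'.1.sup : ℕ) := m1.trans m4'
      exact_mod_cast this
    have i2 : e'.1.inf < e.1.sup := by
      have : ((e'.1.inf : ℕ) : ℝ) < (e.1.sup : ℕ) := m3'.trans m2
      exact_mod_cast this
    have hnest' : ∀ e e' : G.Edge, e'.1.inf ≤ e.1.inf → e.1.sup ≤ e'.1.sup →
        ¬(e'.1.inf = e.1.inf ∧ e.1.sup = e'.1.sup) →
        P e' ≤ P e ∧ Q e ≤ Q e' ∧ Q e - P e + 1 ≤ Q e' - P e' := by
      intro e e' a b hab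
      have := Edge.inf_lt_sup e
      have h3 : (e.1.sup : ℕ) + (e'.1.inf : ℕ) + 1 ≤ (e'.1.sup : ℕ) + (e.1.inf : ℕ) := by
        omega
      have h4 : Q e + P e' + 1 ≤ Q e' + P e := by simp only [P, Q]; exact_mod_cast h3
      refine ⟨?_, ?_, by linarith⟩
      · simp only [P]; exact_mod_cast a
      · simp only [Q]; exact_mod_cast b
    by_cases heq : e.1.inf = e'.1.inf ∧ e.1.sup = e'.1.sup
    · have hP : P e = P e' := by simp only [P, heq.1]
      have hQ : Q e = Q e' := by simp only [Q, heq.2]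
      rw [hP, hQ] at hy
      have h3 := mul_right_cancel₀ hpos'.ne' hy
      simp only [c, hP, hQ] at h3
      have h4 : (e.2 : ℕ) = e'.2 := by
        have : ((e.2 : ℕ) : ℝ) = ((e'.2 : ℕ) : ℝ) := by linarith
        exact_mod_cast this
      have h5 : e.1 = e'.1 := by rw [Edge.eq_mk e, Edge.eq_mk e', heq.1, heq.2]
      obtain ⟨e, p⟩ := e
      obtain ⟨e', p'⟩ := e'
      obtain rfl : e = e' := h5
      exact hne (congrArg (Sigma.mk e) (Fin.ext h4))
    rcases le_total e'.1.inf e.1.inf with a | a <;> rcases le_total e.1.sup e'.1.sup with b | b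
    · obtain ⟨n1, n2, n3⟩ := hnest' e e' a b (by tauto)
      exact (hnest e e' x m1 m2 n1 n2 n3).ne hy
    · by_cases a' : e'.1.inf = e.1.inf
      · obtain ⟨n1, n2, n3⟩ := hnest' e' e a'.ge b (by tauto)
        exact (hnest e' e x m3' m4' n1 n2 n3).ne' hy
      by_cases b' : e.1.sup = e'.1.sup
      · obtain ⟨n1, n2, n3⟩ := hnest' e e' a b'.le (by tauto)
        exact (hnest e e' x m1 m2 n1 n2 n3).ne hy
      rcases h e'.1.inf e.1.inf e'.1.sup e.1.sup (by omega) i1 (by omega) with h | h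
      · exact e'.mult_ne_zero (by rwa [Edge.eq_mk e'])
      · exact e.mult_ne_zero (by rwa [Edge.eq_mk e])
    · by_cases a' : e'.1.inf = e.1.inf
      · obtain ⟨n1, n2, n3⟩ := hnest' e e' a'.le b (by tauto)
        exact (hnest e e' x m1 m2 n1 n2 n3).ne hy
      by_cases b' : e.1.sup = e'.1.sup
      · obtain ⟨n1, n2, n3⟩ := hnest' e' e a b'.ge (by tauto)
        exact (hnest e' e x m3' m4' n1 n2 n3).ne' hy
      rcases h e.1.inf e'.1.inf e.1.sup e'.1.sup (by omega) i2 (by omega) with h | h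
      · exact e.mult_ne_zero (by rwa [Edge.eq_mk e])
      · exact e'.mult_ne_zero (by rwa [Edge.eq_mk e'])
    · obtain ⟨n1, n2, n3⟩ := hnest' e' e a b (by tauto)
      exact (hnest e' e x m3' m4' n1 n2 n3).ne' hy

end Multigraph

/-! ### Degrees of non-crossing graphs -/

namespace Multigraph

variable {m : ℕ} {G : Multigraph m}

theorem card_edge_filter (G : Multigraph m) (p : Sym2 (Fin (m + 1)) → Prop) [DecidablePred p] :
    (Finset.univ.filter fun e : G.Edge => p e.1).card = ∑ e with p e, G.mult e := by
  have : (Finset.univ.filter fun e : G.Edge => p e.1) =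
      (Finset.univ.filter p).sigma fun e => (Finset.univ : Finset (Fin (G.mult e))) := by
    ext e
    simp
  rw [this, Finset.card_sigma]
  simp

theorem degree_eq_sum (G : Multigraph m) (k : Fin (m + 1)) :
    G.degree k = ∑ l, G.mult s(k, l) := by
  have himg : (Finset.univ.filter fun e : Sym2 (Fin (m + 1)) => k ∈ e) =
      Finset.univ.image fun l => s(k, l) := by
    ext e
    simp [Sym2.mem_iff_exists, eq_comm]
  rw [degree, card_edge_filter G (fun e => k ∈ e), himg, Finset.sum_image]
  intro a _ b _ h
  exact Sym2.congr_right.1 h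

/-- The number of edges whose left end is `k`. -/
def rightDeg (G : Multigraph m) (k : Fin (m + 1)) : ℕ :=
  (Finset.univ.filter fun e : G.Edge => e.1.inf = k).card

theorem rightDeg_eq_sum (G : Multigraph m) (k : Fin (m + 1)) :
    G.rightDeg k = ∑ l with k < l, G.mult s(k, l) := by
  rw [rightDeg, card_edge_filter G (fun e => e.inf = k)]
  have himg : (Finset.univ.filter fun e : Sym2 (Fin (m + 1)) => e.inf = k) =
      (Finset.univ.filter fun l => k ≤ l).image fun l => s(k, l) := by
    ext e
    induction e with
    | _ a b =>
      simp only [Sym2.inf_mk, Finset.mem_filter, Finset.mem_univ, true_and, Finset.mem_image]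
      constructor
      · rintro rfl
        rcases le_total a b with h | h
        · exact ⟨b, by simp [h], by simp [h]⟩
        · exact ⟨a, by simp [h], by simp [h, Sym2.eq_swap]⟩
      · rintro ⟨l, hl, h⟩
        rw [← Sym2.inf_mk, ← h, Sym2.inf_mk, inf_eq_left.2 hl]
  rw [himg, Finset.sum_image (fun a _ b _ h => Sym2.congr_right.1 h)]
  symm
  apply Finset.sum_subset
  · intro l
    simp only [Finset.mem_filter, Finset.mem_univ, true_and]
    exact le_of_lt
  · intro l
    simp only [Finset.mem_filter, Finset.mem_univ, true_and, not_lt]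
    intro h1 h2
    rw [le_antisymm h2 h1, G.loopless]

theorem degree_eq_rightDeg_add (G : Multigraph m) (k : Fin (m + 1)) :
    G.degree k = G.rightDeg k + ∑ l with l < k, G.mult s(l, k) := by
  rw [degree_eq_sum, rightDeg_eq_sum,
    ← Finset.sum_filter_add_sum_filter_not Finset.univ (fun l => k < l)]
  congr 1
  symm
  simp_rw [Sym2.eq_swap (a := k)]
  apply Finset.sum_subset
  · intro l
    simp only [Finset.mem_filter, Finset.mem_univ, true_and, not_lt]
    exact le_of_lt
  · intro l
    simp only [Finset.mem_filter, Finset.mem_univ, true_and, not_lt]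
    intro h1 h2
    rw [le_antisymm h1 h2, G.loopless]

theorem degree_zero_eq_sum (G : Multigraph m) :
    G.degree 0 = ∑ k : Fin m, G.mult s(0, k.succ) := by
  rw [degree_eq_sum, Fin.sum_univ_succ, G.loopless, zero_add]

/-- In a non-crossing graph the edges between `k` and `l` exhaust what the shorter edges inside
`[k, l]` leave of the right degree of `k` or of the left degree of `l`. -/
theorem IsNonCrossing.mult_eq_min (h : G.IsNonCrossing) {k l : Fin (m + 1)} (hkl : k < l) :
    G.mult s(k, l) =
      min (G.rightDeg k - ∑ j with k < j ∧ j < l, G.mult s(k, j))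
        ((∑ j with j < l, G.mult s(j, l)) - ∑ j with k < j ∧ j < l, G.mult s(j, l)) := by
  have e1 : G.mult s(k, l) = ∑ j, if j = l then G.mult s(k, j) else 0 := by simp
  have e2 : G.mult s(k, l) = ∑ j, if j = k then G.mult s(j, l) else 0 := by simp
  have h1 : G.rightDeg k = (∑ j with k < j ∧ j < l, G.mult s(k, j)) + G.mult s(k, l) +
      ∑ j with l < j, G.mult s(k, j) := by
    rw [rightDeg_eq_sum, Finset.sum_filter, Finset.sum_filter, Finset.sum_filter, e1,
      ← Finset.sum_add_distrib, ← Finset.sum_add_distrib]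
    refine Finset.sum_congr rfl fun j _ => ?_
    rcases lt_trichotomy j l with h | rfl | h
    · simp [h, h.ne, h.not_gt]
    · simp [hkl]
    · simp [h, h.ne', h.not_gt, hkl.trans h]
  have h2 : (∑ j with j < l, G.mult s(j, l)) = (∑ j with k < j ∧ j < l, G.mult s(j, l)) +
      G.mult s(k, l) + ∑ j with j < k, G.mult s(j, l) := by
    rw [Finset.sum_filter, Finset.sum_filter, Finset.sum_filter, e2,
      ← Finset.sum_add_distrib, ← Finset.sum_add_distrib]
    refine Finset.sum_congr rfl fun j _ => ?_
    rcases lt_trichotomy j k with h | rfl | h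
    · simp [h, h.ne, h.not_gt, h.trans hkl]
    · simp [hkl]
    · simp [h, h.ne', h.not_gt]
  -- An edge from `k` to beyond `l` and one from `l` to before `k` would cross.
  have h3 : (∑ j with l < j, G.mult s(k, j)) = 0 ∨ (∑ j with j < k, G.mult s(j, l)) = 0 := by
    by_contra! hne
    obtain ⟨j, hj, hj'⟩ := Finset.exists_ne_zero_of_sum_ne_zero hne.1
    obtain ⟨i, hi, hi'⟩ := Finset.exists_ne_zero_of_sum_ne_zero hne.2
    simp only [Finset.mem_filter, Finset.mem_univ, true_and] at hi hj
    rcases h i k l j hi hkl hj with h | h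
    · exact hi' h
    · exact hj' h
  omega

/-- A non-crossing graph is determined by the degrees and right degrees of its vertices
`1, …, m`. -/
theorem IsNonCrossing.eq_of_rightDeg_eq {G' : Multigraph m} (h : G.IsNonCrossing)
    (h' : G'.IsNonCrossing) (hd : ∀ k : Fin m, G.degree k.succ = G'.degree k.succ)
    (hr : ∀ k : Fin m, G.rightDeg k.succ = G'.rightDeg k.succ) : G = G' := by
  have hleft : ∀ l : Fin (m + 1), l ≠ 0 →
      (∑ j with j < l, G.mult s(j, l)) = ∑ j with j < l, G'.mult s(j, l) := by
    intro l hl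
    obtain ⟨l, rfl⟩ := Fin.exists_succ_eq.2 hl
    have h1 := degree_eq_rightDeg_add G l.succ
    have h2 := degree_eq_rightDeg_add G' l.succ
    have h3 := hd l
    have h4 := hr l
    omega
  have hpos : ∀ n, ∀ k l : Fin (m + 1), k ≠ 0 → k < l → (l : ℕ) - k = n →
      G.mult s(k, l) = G'.mult s(k, l) := by
    intro n
    induction n using Nat.strong_induction_on with
    | _ n ih =>
      intro k l hk hkl hn
      have hrk : G.rightDeg k = G'.rightDeg k := by
        obtain ⟨k, rfl⟩ := Fin.exists_succ_eq.2 hk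
        exact hr k
      rw [h.mult_eq_min hkl, h'.mult_eq_min hkl, hrk, hleft l (Fin.ne_zero_of_lt hkl)]
      congr 2
      · refine Finset.sum_congr rfl fun j hj => ?_
        simp only [Finset.mem_filter, Finset.mem_univ, true_and] at hj
        exact ih _ (by omega) k j hk hj.1 rfl
      · refine Finset.sum_congr rfl fun j hj => ?_
        simp only [Finset.mem_filter, Finset.mem_univ, true_and] at hj
        exact ih _ (by omega) j l (Fin.ne_zero_of_lt hj.1) hj.2 rfl
  have hzero : ∀ l : Fin (m + 1), l ≠ 0 → G.mult s(0, l) = G'.mult s(0, l) := by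
    intro l hl
    have h1 := hleft l hl
    have hmem : (0 : Fin (m + 1)) ∈ Finset.univ.filter (· < l) := by
      simpa using Fin.pos_iff_ne_zero.2 hl
    rw [← Finset.add_sum_erase _ _ hmem, ← Finset.add_sum_erase _ _ hmem] at h1
    have h2 : (∑ j ∈ (Finset.univ.filter (· < l)).erase 0, G.mult s(j, l)) =
        ∑ j ∈ (Finset.univ.filter (· < l)).erase 0, G'.mult s(j, l) := by
      refine Finset.sum_congr rfl fun j hj => ?_
      simp only [Finset.mem_erase, Finset.mem_filter, Finset.mem_univ, true_and] at hj
      exact hpos _ j l hj.1 hj.2 rfl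
    omega
  have hlt : ∀ k l : Fin (m + 1), k < l → G.mult s(k, l) = G'.mult s(k, l) := by
    intro k l hkl
    by_cases hk : k = 0
    · subst hk
      exact hzero l hkl.ne'
    · exact hpos _ k l hk hkl rfl
  ext e
  induction e with
  | _ a b =>
    rcases lt_trichotomy a b with h | rfl | h
    · exact hlt a b h
    · rw [G.loopless, G'.loopless]
    · rw [Sym2.eq_swap]
      exact hlt b a h

/-- The graph `G` with one more edge, between `k` and `l`. -/
def addEdge (G : Multigraph m) (k l : Fin (m + 1)) (hkl : k ≠ l) : Multigraph m where
  mult e := G.mult e + if e = s(k, l) then 1 else 0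
  loopless j := by
    rw [G.loopless, if_neg]
    intro h
    rw [Sym2.eq_iff] at h
    rcases h with ⟨h1, h2⟩ | ⟨h1, h2⟩ <;> exact hkl (by rw [← h1, ← h2])

theorem degree_addEdge (G : Multigraph m) {k l : Fin (m + 1)} (hkl : k < l) (j : Fin (m + 1)) :
    (G.addEdge k l hkl.ne).degree j =
      G.degree j + ((if j = k then 1 else 0) + if j = l then 1 else 0) := by
  rw [degree_eq_sum, degree_eq_sum]
  simp only [addEdge, Finset.sum_add_distrib]
  congr 1
  have : ∀ i, (if s(j, i) = s(k, l) then 1 else 0) =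
      (if i = l then if j = k then 1 else 0 else 0) +
        if i = k then if j = l then 1 else 0 else 0 := by
    intro i
    simp only [Sym2.eq_iff]
    have := hkl.ne
    split_ifs <;> first | rfl | (exfalso; omega)
  rw [Finset.sum_congr rfl fun i _ => this i]
  simp [Finset.sum_add_distrib]

theorem rightDeg_addEdge (G : Multigraph m) {k l : Fin (m + 1)} (hkl : k < l)
    (j : Fin (m + 1)) :
    (G.addEdge k l hkl.ne).rightDeg j = G.rightDeg j + if j = k then 1 else 0 := by
  rw [rightDeg_eq_sum, rightDeg_eq_sum]
  simp only [addEdge, Finset.sum_add_distrib]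
  congr 1
  rw [Finset.sum_filter]
  have : ∀ i, (if j < i then if s(j, i) = s(k, l) then 1 else 0 else 0) =
      if i = l then if j = k then 1 else 0 else 0 := by
    intro i
    simp only [Sym2.eq_iff]
    split_ifs <;> first | rfl | (exfalso; omega)
  rw [Finset.sum_congr rfl fun i _ => this i]
  simp

theorem mult_eq_zero_of_degree_eq_zero {k : Fin (m + 1)} (h : G.degree k = 0)
    (l : Fin (m + 1)) : G.mult s(k, l) = 0 := by
  rw [degree_eq_sum, Finset.sum_eq_zero_iff] at h
  exact h l (Finset.mem_univ _)

theorem IsNonCrossing.addEdge (h : G.IsNonCrossing) {k l : Fin (m + 1)} (hkl : k < l)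
    (hdeg : ∀ j, k < j → j < l → G.degree j = 0) :
    (G.addEdge k l hkl.ne).IsNonCrossing := by
  intro a b c e hab hbc hce
  have hz : ∀ j, k < j → j < l → ∀ i, G.mult s(j, i) = 0 ∧ G.mult s(i, j) = 0 := fun j h1 h2 i => by
    have := mult_eq_zero_of_degree_eq_zero (hdeg j h1 h2) i
    exact ⟨this, by rwa [Sym2.eq_swap]⟩
  simp only [Multigraph.addEdge, Sym2.eq_iff]
  by_cases h1 : a = k ∧ c = l
  · right
    rw [(hz b (h1.1 ▸ hab) (h1.2 ▸ hbc) e).1, if_neg (by omega)]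
  by_cases h2 : b = k ∧ e = l
  · left
    rw [(hz c (h2.1 ▸ hbc) (h2.2 ▸ hce) a).2, if_neg (by omega)]
  rw [if_neg (by omega), if_neg (by omega)]
  exact h a b c e hab hbc hce

/-- The graph with `d k` edges between `0` and `k + 1`, and no others. -/
def star (d : Fin m → ℕ) : Multigraph m where
  mult := Sym2.lift ⟨fun k l => (if k = 0 then (Fin.cons 0 d : Fin (m + 1) → ℕ) l else 0) +
    if l = 0 then (Fin.cons 0 d : Fin (m + 1) → ℕ) k else 0, fun k l => add_comm _ _⟩
  loopless k := by
    simp only [Sym2.lift_mk]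
    split_ifs with h
    · simp [h]
    · rfl

theorem star_mult_zero (d : Fin m → ℕ) (k : Fin m) : (star d).mult s(0, k.succ) = d k := by
  simp [star]

theorem star_mult_succ (d : Fin m → ℕ) {k l : Fin (m + 1)} (hk : k ≠ 0) (hl : l ≠ 0) :
    (star d).mult s(k, l) = 0 := by
  simp [star, hk, hl]

theorem star_degree (d : Fin m → ℕ) (k : Fin m) : (star d).degree k.succ = d k := by
  rw [degree_eq_sum, Fin.sum_univ_succ, Sym2.eq_swap, star_mult_zero]
  simp [star_mult_succ]

theorem star_rightDeg (d : Fin m → ℕ) (k : Fin m) : (star d).rightDeg k.succ = 0 := by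
  rw [rightDeg_eq_sum]
  refine Finset.sum_eq_zero fun l hl => ?_
  simp only [Finset.mem_filter, Finset.mem_univ, true_and] at hl
  exact star_mult_succ d (Fin.succ_ne_zero k) (Fin.ne_zero_of_lt hl)

theorem star_isNonCrossing (d : Fin m → ℕ) : (star d).IsNonCrossing := fun _ _ _ _ hik _ hjl =>
  Or.inr (star_mult_succ d (Fin.ne_zero_of_lt hik) (Fin.ne_zero_of_lt hjl))

/-- `HasWord G u a` says that `a` records the `x`-exponents of the following orientation of `G`:
edges not ending in `0` point to the right, and the first edges at `0` leave `0` while the last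
ones, `u k` of them at the vertex `k + 1`, enter it. -/
structure HasWord (G : Multigraph m) (u a : Fin m → ℕ) : Prop where
  le : ∀ k, u k ≤ G.mult s(0, k.succ)
  eq : ∀ k, a k = G.rightDeg k.succ + u k
  mono : ∀ k l, k < l → u k ≠ 0 → u l = G.mult s(0, l.succ)

/-- Every choice of `x`-exponents comes from a non-crossing graph: read `x` as an opening and `y`
as a closing bracket, and join matching brackets by edges and unmatched ones to `0`. -/
theorem exists_hasWord : ∀ (n : ℕ) (d a : Fin m → ℕ), (∀ k, a k ≤ d k) → ∑ k, d k = n →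
    ∃ (G : Multigraph m) (u : Fin m → ℕ), G.IsNonCrossing ∧
      (∀ k : Fin m, G.degree k.succ = d k) ∧ HasWord G u a := by
  intro n
  induction n using Nat.strong_induction_on with
  | _ n ih =>
    intro d a had hn
    by_cases hex : ∃ p : Fin m × Fin m, p.1 < p.2 ∧ a p.1 ≠ 0 ∧ a p.2 < d p.2
    · -- A closest pair of an opening bracket before a closing one has no brackets in between.
      have hne : (Finset.univ.filter fun p : Fin m × Fin m =>
          p.1 < p.2 ∧ a p.1 ≠ 0 ∧ a p.2 < d p.2).Nonempty := by
        obtain ⟨p, hp⟩ := hex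
        exact ⟨p, by simpa using hp⟩
      obtain ⟨⟨k, l⟩, hkl, hmin⟩ := Finset.exists_min_image _
        (fun p : Fin m × Fin m => (p.2 : ℕ) - p.1) hne
      simp only [Finset.mem_filter, Finset.mem_univ, true_and, Prod.forall] at hkl hmin
      obtain ⟨hlt, hak, hal⟩ := hkl
      have hgap : ∀ j, k < j → j < l → d j = 0 := by
        intro j h1 h2
        by_contra hj
        by_cases haj : a j = 0
        · have := hmin k j ⟨h1, hak, by omega⟩
          omega
        · have := hmin j l ⟨h2, haj, hal⟩
          omega
      have hk0 := had k
      let d' : Fin m → ℕ := fun j => d j - ((if j = k then 1 else 0) + if j = l then 1 else 0)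
      let a' : Fin m → ℕ := fun j => a j - if j = k then 1 else 0
      have hd' : ∀ j, d j = d' j + ((if j = k then 1 else 0) + if j = l then 1 else 0) := by
        intro j
        simp only [d']
        by_cases hjk : j = k
        · subst hjk
          have := hlt.ne
          simp only [if_true, if_neg this]
          omega
        · by_cases hjl : j = l
          · subst hjl
            simp only [if_true, if_neg hjk]
            omega
          · simp [hjk, hjl]
      have ha' : ∀ j, a j = a' j + if j = k then 1 else 0 := by
        intro j
        simp only [a']
        by_cases hjk : j = k
        · subst hjk
          simp only [if_true]
          omega
        · simp [hjk]
      have hsum : ∑ j, d j = ∑ j, d' j + 2 := by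
        rw [Finset.sum_congr rfl fun j _ => hd' j]
        simp [Finset.sum_add_distrib]
      obtain ⟨G, u, hG, hdeg, hw⟩ := ih (∑ j, d' j) (by omega) d' a' (by
        intro j
        have h1 := hd' j
        have h2 := ha' j
        have h3 := had j
        by_cases hjl : j = l
        · subst hjl
          simp only [if_neg hlt.ne', if_true] at h1 h2
          omega
        · simp only [if_neg hjl] at h1
          omega) rfl
      have hlt' : k.succ < l.succ := Fin.succ_lt_succ_iff.2 hlt
      have hmult : ∀ j : Fin m, (G.addEdge k.succ l.succ hlt'.ne).mult s(0, j.succ) =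
          G.mult s(0, j.succ) := by
        intro j
        simp only [Multigraph.addEdge, Nat.add_eq_left, ite_eq_right_iff, one_ne_zero, imp_false]
        rw [Sym2.eq_iff]
        have h1 := Fin.succ_ne_zero k
        have h2 := Fin.succ_ne_zero l
        tauto
      refine ⟨G.addEdge k.succ l.succ hlt'.ne, u, hG.addEdge hlt' ?_, ?_, ?_, ?_, ?_⟩
      · intro j h1 h2
        obtain ⟨j, rfl⟩ := Fin.exists_succ_eq.2 (Fin.ne_zero_of_lt h1)
        rw [Fin.succ_lt_succ_iff] at h1 h2
        rw [hdeg]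
        have := hd' j
        have := hgap j h1 h2
        omega
      · intro j
        rw [degree_addEdge G hlt', hdeg, hd' j]
        simp only [Fin.succ_inj]
      · intro j
        rw [hmult]
        exact hw.le j
      · intro j
        rw [rightDeg_addEdge G hlt', ha' j, hw.eq j]
        simp only [Fin.succ_inj]
        omega
      · intro i j hij hi
        rw [hmult]
        exact hw.mono i j hij hi
    · -- No opening bracket precedes a closing one: join everything to `0`.
      push Not at hex
      refine ⟨star d, a, star_isNonCrossing d, star_degree d, ⟨?_, ?_, ?_⟩⟩
      · intro k
        rw [star_mult_zero]
        exact had k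
      · intro k
        rw [star_rightDeg, zero_add]
      · intro k l hkl hk
        rw [star_mult_zero]
        exact le_antisymm (had l) (hex (k, l) hkl hk)

/-- A word is determined by its graph and the number of arrows ending in `0`. -/
theorem HasWord.eq_of_sum_eq {u u' a a' : Fin m → ℕ} (h : G.HasWord u a) (h' : G.HasWord u' a')
    (hs : ∑ k, u k = ∑ k, u' k) : a = a' := by
  have huu : u = u' := by
    by_contra hne
    have hlt : ∃ k, u k < u' k := by
      by_contra! hc
      exact hne (funext fun k =>
        ((Finset.sum_eq_sum_iff_of_le fun i _ => hc i).1 hs.symm k (Finset.mem_univ k)).symm)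
    have hgt : ∃ k, u' k < u k := by
      by_contra! hc
      exact hne (funext fun k =>
        (Finset.sum_eq_sum_iff_of_le fun i _ => hc i).1 hs k (Finset.mem_univ k))
    obtain ⟨k, hk⟩ := hlt
    obtain ⟨l, hl⟩ := hgt
    rcases lt_trichotomy k l with hkl | rfl | hkl
    · have h1 := h'.mono k l hkl (by omega)
      have h2 := h.le l
      omega
    · omega
    · have h1 := h.mono l k hkl (by omega)
      have h2 := h'.le k
      omega
  funext k
  rw [h.eq, h'.eq, huu]

end Multigraph

/-! ### Monomials and powers of linear forms in `S^k V` -/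

section SymPow

variable {f : Type*} [Field f]

/-- The exponent of the monomial `x^a y^b`. -/
def expo (a b : ℕ) : Fin 2 →₀ ℕ := Finsupp.single 0 a + Finsupp.single 1 b

theorem expo_inj {a b a' b' : ℕ} : expo a b = expo a' b' ↔ a = a' ∧ b = b' := by
  constructor
  · intro h
    have h0 := DFunLike.congr_fun h 0
    have h1 := DFunLike.congr_fun h 1
    simpa [expo] using And.intro h0 h1
  · rintro ⟨rfl, rfl⟩
    rfl

theorem eq_expo (s : Fin 2 →₀ ℕ) : s = expo (s 0) (s 1) := by
  ext j
  fin_cases j <;> simp [expo]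

theorem coe_xy {k a b : ℕ} (h : a + b = k) :
    (xy f a b h : MvPolynomial (Fin 2) f) = MvPolynomial.monomial (expo a b) 1 := by
  simp [xy, expo, MvPolynomial.X_pow_eq_monomial, MvPolynomial.monomial_mul]

theorem add_sub_cancel_fin {k : ℕ} (i : Fin (k + 1)) : (i : ℕ) + (k - i) = k := by
  omega

/-- The coordinates of a form of degree `k` with respect to the monomials `x^i y^(k-i)`. -/
def symEquivFun (f : Type*) [Field f] (k : ℕ) : SymPow f k ≃ₗ[f] (Fin (k + 1) → f) where
  toFun p i := MvPolynomial.coeff (expo i (k - i)) (p : MvPolynomial (Fin 2) f)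
  map_add' p q := by ext; simp
  map_smul' r p := by ext; simp
  invFun v := ∑ i : Fin (k + 1), v i • xy f i (k - i) (add_sub_cancel_fin i)
  left_inv p := by
    ext s
    simp only [Submodule.coe_sum, Submodule.coe_smul, coe_xy, MvPolynomial.coeff_sum,
      MvPolynomial.coeff_smul, MvPolynomial.coeff_monomial, smul_eq_mul, mul_ite, mul_one, mul_zero]
    rw [eq_expo s]
    by_cases hs : s 0 + s 1 = k
    · rw [Finset.sum_eq_single (⟨s 0, by omega⟩ : Fin (k + 1))]
      · have : k - s 0 = s 1 := by omega
        simp [this]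
      · intro i _ hi
        rw [if_neg]
        rw [expo_inj]
        rintro ⟨h, -⟩
        exact hi (Fin.ext h)
      · simp
    · rw [Finset.sum_eq_zero]
      · symm
        by_contra hne
        have h1 := (MvPolynomial.mem_homogeneousSubmodule _ _).1 p.2 hne
        rw [Finsupp.weight_apply, Finsupp.sum_fintype _ _ (by simp)] at h1
        simp [expo] at h1
        exact hs h1
      · intro i _
        rw [if_neg]
        rw [expo_inj]
        omega
  right_inv v := by
    ext i
    simp only [Submodule.coe_sum, Submodule.coe_smul, coe_xy, MvPolynomial.coeff_sum,
      MvPolynomial.coeff_smul, MvPolynomial.coeff_monomial, smul_eq_mul, mul_ite, mul_one, mul_zero]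
    rw [Finset.sum_eq_single i]
    · simp
    · intro j _ hj
      rw [if_neg]
      rw [expo_inj]
      rintro ⟨h, -⟩
      exact hj (Fin.ext h)
    · simp

/-- The basis of `S^k V` formed by the monomials `x^i y^(k-i)`. -/
def symBasis (f : Type*) [Field f] (k : ℕ) : Module.Basis (Fin (k + 1)) f (SymPow f k) :=
  Module.Basis.ofEquivFun (symEquivFun f k)

theorem symBasis_apply (k : ℕ) (i : Fin (k + 1)) :
    symBasis f k i = xy f i (k - i) (add_sub_cancel_fin i) := by
  rw [symBasis, Module.Basis.coe_ofEquivFun]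
  simp [symEquivFun, Pi.single_apply]

theorem symBasis_repr_xy {k a b : ℕ} (h : a + b = k) (i : Fin (k + 1)) :
    (symBasis f k).repr (xy f a b h) i = if (i : ℕ) = a then 1 else 0 := by
  rw [symBasis, Module.Basis.ofEquivFun_repr_apply]
  simp only [symEquivFun, LinearEquiv.coe_mk, LinearMap.coe_mk, AddHom.coe_mk, coe_xy,
    MvPolynomial.coeff_monomial, expo_inj]
  congr 1
  apply propext
  omega

/-- The `k`-th power of the linear form `α x + β y`. -/
def linPow (k : ℕ) (α β : f) : SymPow f k :=
  ⟨(MvPolynomial.C α * MvPolynomial.X 0 + MvPolynomial.C β * MvPolynomial.X 1) ^ k, by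
    rw [MvPolynomial.mem_homogeneousSubmodule]
    have h : ∀ (r : f) (j : Fin 2),
        (MvPolynomial.C r * MvPolynomial.X j : MvPolynomial (Fin 2) f).IsHomogeneous 1 :=
      fun r j => by
        simpa using (MvPolynomial.isHomogeneous_C (Fin 2) r).mul (MvPolynomial.isHomogeneous_X f j)
    simpa using ((h α 0).add (h β 1)).pow k⟩

theorem coe_linPow (k : ℕ) (α β : f) : (linPow k α β : MvPolynomial (Fin 2) f) =
    (MvPolynomial.C α * MvPolynomial.X 0 + MvPolynomial.C β * MvPolynomial.X 1) ^ k :=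
  rfl

theorem linPow_eq_sum (k : ℕ) (α β : f) :
    linPow k α β = ∑ i : Fin (k + 1), (α ^ (i : ℕ) * β ^ (k - i) * (k.choose i : f)) •
      xy f i (k - i) (add_sub_cancel_fin i) := by
  ext1
  simp only [linPow, add_pow, Submodule.coe_sum, Submodule.coe_smul, xy]
  rw [Finset.sum_range]
  refine Finset.sum_congr rfl fun i _ => ?_
  simp only [MvPolynomial.smul_eq_C_mul, map_mul, map_pow, map_natCast]
  ring

theorem rho_linPow (k : ℕ) (g : Matrix.SpecialLinearGroup (Fin 2) f) (α β : f) :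
    rho f k g (linPow k α β) =
      linPow k (α * g 0 0 + β * g 0 1) (α * g 1 0 + β * g 1 1) := by
  ext1
  change changeVars (g : Matrix (Fin 2) (Fin 2) f) (linPow k α β : MvPolynomial (Fin 2) f) = _
  simp only [coe_linPow, changeVars, map_pow, map_add, map_mul, MvPolynomial.aeval_X,
    MvPolynomial.algHom_C, MvPolynomial.algebraMap_eq, Fin.sum_univ_two]
  ring

/-- A polynomial function with vector coefficients on an infinite field vanishes only if its
coefficients do. -/
theorem eq_zero_of_forall_sum_pow_smul_eq_zero [Infinite f] {W : Type*} [AddCommGroup W]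
    [Module f W] {n : ℕ} {v : ℕ → W}
    (h : ∀ τ : f, ∑ i ∈ Finset.range n, τ ^ i • v i = 0) {i : ℕ} (hi : i < n) : v i = 0 := by
  rw [← Module.forall_dual_apply_eq_zero_iff f]
  intro φ
  have hp : (∑ i ∈ Finset.range n, Polynomial.monomial i (φ (v i)) : Polynomial f) = 0 := by
    apply Polynomial.funext
    intro τ
    have := congrArg φ (h τ)
    simp only [map_sum, map_smul, smul_eq_mul, map_zero] at this
    simp only [Polynomial.eval_finsetSum, Polynomial.eval_monomial, Polynomial.eval_zero]
    rw [← this]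
    exact Finset.sum_congr rfl fun _ _ => mul_comm _ _
  have := congrArg (fun p => Polynomial.coeff p i) hp
  simpa [Polynomial.finsetSum_coeff, Polynomial.coeff_monomial, hi] using this

theorem span_linPow_eq_top [CharZero f] (k : ℕ) :
    Submodule.span f (Set.range fun α : f => linPow k α 1) = ⊤ := by
  set W := Submodule.span f (Set.range fun α : f => linPow k α 1) with hW
  let v : ℕ → SymPow f k ⧸ W := fun i =>
    if h : i < k + 1 then W.mkQ ((k.choose i : f) • xy f i (k - i) (by omega)) else 0
  have hv : ∀ τ : f, ∑ i ∈ Finset.range (k + 1), τ ^ i • v i = 0 := by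
    intro τ
    have h1 : W.mkQ (linPow k τ 1) = 0 := by
      rw [Submodule.mkQ_apply, Submodule.Quotient.mk_eq_zero]
      exact Submodule.subset_span ⟨τ, rfl⟩
    rw [linPow_eq_sum, map_sum] at h1
    rw [Finset.sum_range, ← h1]
    refine Finset.sum_congr rfl fun i _ => ?_
    simp only [v, dif_pos i.2, one_pow, mul_one, map_smul, mul_smul]
  rw [eq_top_iff, ← (symBasis f k).span_eq, Submodule.span_le]
  rintro _ ⟨i, rfl⟩
  have h2 := eq_zero_of_forall_sum_pow_smul_eq_zero hv i.2
  simp only [v, dif_pos i.2] at h2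
  rw [map_smul, smul_eq_zero] at h2
  have h3 : (k.choose i : f) ≠ 0 := by
    have := (Nat.choose_pos (show (i : ℕ) ≤ k by omega)).ne'
    exact_mod_cast this
  have h4 := h2.resolve_left h3
  rw [Submodule.mkQ_apply, Submodule.Quotient.mk_eq_zero] at h4
  rwa [SetLike.mem_coe, symBasis_apply]

end SymPow

/-! ### The tensor product as a space of multihomogeneous polynomials -/

section TensorSpace

variable {f : Type*} [Field f] {m : ℕ} {d : Fin m → ℕ}

/-- The basis of the tensor product formed by the tensors of monomials. -/
def tensorBasis (f : Type*) [Field f] {m : ℕ} (d : Fin m → ℕ) :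
    Module.Basis (Π k, Fin (d k + 1)) f (TensorSpace f d) :=
  Basis.piTensorProduct fun k => symBasis f (d k)

theorem tensorBasis_repr_tprod_xy {a b : Fin m → ℕ} (h : ∀ k, a k + b k = d k)
    (p : Π k, Fin (d k + 1)) :
    (tensorBasis f d).repr (PiTensorProduct.tprod f fun k => xy f (a k) (b k) (h k)) p =
      if ∀ k, (p k : ℕ) = a k then 1 else 0 := by
  rw [tensorBasis, Basis.piTensorProduct_repr_tprod_apply]
  simp only [symBasis_repr_xy]
  rw [Finset.prod_ite_zero]
  simp

/-- The embedding of the tensor product into the polynomials in the variables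
`x_k = X (k, 0)` and `y_k = X (k, 1)`, which puts the `k`-th pair of variables into the factor
with index `k` and multiplies. -/
def toPoly (f : Type*) [Field f] {m : ℕ} (d : Fin m → ℕ) :
    TensorSpace f d →ₗ[f] MvPolynomial (Fin m × Fin 2) f :=
  PiTensorProduct.lift ((MultilinearMap.mkPiAlgebra f (Fin m) _).compLinearMap fun k =>
    (MvPolynomial.rename fun j => (k, j)).toLinearMap ∘ₗ
      (MvPolynomial.homogeneousSubmodule (Fin 2) f (d k)).subtype)

theorem toPoly_tprod (p : Π k, SymPow f (d k)) :
    toPoly f d (PiTensorProduct.tprod f p) =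
      ∏ k, MvPolynomial.rename (fun j => (k, j)) (p k : MvPolynomial (Fin 2) f) := by
  simp [toPoly]

theorem toPoly_tprod_xy {a b : Fin m → ℕ} (h : ∀ k, a k + b k = d k) :
    toPoly f d (PiTensorProduct.tprod f fun k => xy f (a k) (b k) (h k)) =
      (∏ k, MvPolynomial.X (k, 0) ^ a k) * ∏ k, MvPolynomial.X (k, 1) ^ b k := by
  rw [toPoly_tprod, ← Finset.prod_mul_distrib]
  simp [xy]

theorem toPoly_injective : Function.Injective (toPoly f d) := by
  let E : (Π k, Fin (d k + 1)) → (Fin m × Fin 2 →₀ ℕ) := fun p =>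
    Finsupp.equivFunOnFinite.symm fun kj => if kj.2 = 0 then (p kj.1 : ℕ) else d kj.1 - p kj.1
  have hE : Function.Injective E := fun p q h => by
    funext k
    have := DFunLike.congr_fun h (k, 0)
    exact Fin.ext (by simpa only [E, Finsupp.equivFunOnFinite_symm_apply_apply, if_true] using this)
  have hb : ∀ p, toPoly f d (tensorBasis f d p) = MvPolynomial.monomial (E p) 1 := fun p => by
    rw [tensorBasis, Basis.piTensorProduct_apply]
    simp only [symBasis_apply]
    rw [toPoly_tprod_xy fun k => add_sub_cancel_fin (p k), MvPolynomial.monomial_eq,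
      Finsupp.prod_fintype _ _ (by simp), Fintype.prod_prod_type, ← Finset.prod_mul_distrib]
    simp [E, Fin.prod_univ_two]
  have hcoord : ∀ p, MvPolynomial.lcoeff f (E p) ∘ₗ toPoly f d = (tensorBasis f d).coord p := by
    intro p
    refine (tensorBasis f d).ext fun q => ?_
    rw [LinearMap.comp_apply, hb, MvPolynomial.lcoeff_apply, MvPolynomial.coeff_monomial,
      Module.Basis.coord_apply, Module.Basis.repr_self, Finsupp.single_apply]
    simp only [hE.eq_iff]
  rw [injective_iff_map_eq_zero]
  intro v hv
  refine (tensorBasis f d).ext_elem fun p => ?_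
  have := LinearMap.congr_fun (hcoord p) v
  rw [LinearMap.comp_apply, hv, map_zero, Module.Basis.coord_apply] at this
  rw [← this, map_zero, Finsupp.zero_apply]

/-- The simultaneous change of all pairs of variables by `g`. -/
def actPoly (m : ℕ) (g : Matrix (Fin 2) (Fin 2) f) :
    MvPolynomial (Fin m × Fin 2) f →ₐ[f] MvPolynomial (Fin m × Fin 2) f :=
  MvPolynomial.aeval fun kj => ∑ i, MvPolynomial.C (g i kj.2) * MvPolynomial.X (kj.1, i)

theorem toPoly_rhoTensor (g : Matrix.SpecialLinearGroup (Fin 2) f) (v : TensorSpace f d) :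
    toPoly f d (rhoTensor f d g v) = actPoly m g (toPoly f d v) := by
  have : toPoly f d ∘ₗ rhoTensor f d g = (actPoly m (g : Matrix (Fin 2) (Fin 2) f)).toLinearMap ∘ₗ
      toPoly f d := by
    apply PiTensorProduct.ext
    ext1 p
    simp only [LinearMap.compMultilinearMap_apply, LinearMap.comp_apply, rhoTensor,
      MonoidHom.coe_mk, OneHom.coe_mk, PiTensorProduct.map_tprod, toPoly_tprod,
      AlgHom.toLinearMap_apply, map_prod]
    refine Finset.prod_congr rfl fun k _ => ?_
    have : (MvPolynomial.rename fun j => (k, j)).comp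
        (changeVars (g : Matrix (Fin 2) (Fin 2) f)) =
        (actPoly m (g : Matrix (Fin 2) (Fin 2) f)).comp (MvPolynomial.rename fun j => (k, j)) := by
      apply MvPolynomial.algHom_ext
      intro j
      simp [changeVars, actPoly]
    exact DFunLike.congr_fun this (p k : MvPolynomial (Fin 2) f)
  exact LinearMap.congr_fun this v

end TensorSpace

/-! ### Equivariance of `s_G` -/

section Equivariance

variable {f : Type*} [Field f] {m : ℕ} {d : Fin m → ℕ}

/-- The variable `x_k`; at the vertex `0` the scalar `β` is substituted for it. -/
def xVar (m : ℕ) (β : f) : Fin (m + 1) → MvPolynomial (Fin m × Fin 2) f :=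
  Fin.cons (MvPolynomial.C β) fun k => MvPolynomial.X (k, 0)

/-- The variable `y_k`; at the vertex `0` the scalar `-α` is substituted for it. -/
def yVar (m : ℕ) (α : f) : Fin (m + 1) → MvPolynomial (Fin m × Fin 2) f :=
  Fin.cons (MvPolynomial.C (-α)) fun k => MvPolynomial.X (k, 1)

/-- The contribution `± x_k y_l` of an arrow from `k` to `l`. -/
def arrowTerm (α β : f) (p : Fin (m + 1) × Fin (m + 1)) : MvPolynomial (Fin m × Fin 2) f :=
  (-1) ^ (if p.2 < p.1 then 1 else 0) * xVar m β p.1 * yVar m α p.2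

/-- The factor `x_k y_l - x_l y_k` of an edge with ends `k < l`, as the sum of the contributions
of its two orientations. With `k = 0` it is the linear form `α x_l + β y_l`. -/
def edgeFactor (α β : f) (e : Sym2 (Fin (m + 1))) : MvPolynomial (Fin m × Fin 2) f :=
  ∑ p : Fin (m + 1) × Fin (m + 1) with s(p.1, p.2) = e, arrowTerm α β p

theorem edgeFactor_mk (α β : f) {k l : Fin (m + 1)} (h : k < l) :
    edgeFactor α β s(k, l) = xVar m β k * yVar m α l - xVar m β l * yVar m α k := by
  have hset : (Finset.univ.filter fun p : Fin (m + 1) × Fin (m + 1) => s(p.1, p.2) = s(k, l)) =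
      {(k, l), (l, k)} := by
    ext ⟨a, b⟩
    simp
  rw [edgeFactor, hset, Finset.sum_pair (by simp [h.ne])]
  simp [arrowTerm, h, h.not_gt]
  ring

theorem actPoly_edgeFactor (g : Matrix.SpecialLinearGroup (Fin 2) f) (α β : f)
    {k l : Fin (m + 1)} (h : k < l) :
    actPoly m g (edgeFactor α β s(k, l)) =
      edgeFactor (α * g 0 0 + β * g 0 1) (α * g 1 0 + β * g 1 1) s(k, l) := by
  rw [edgeFactor_mk _ _ h, edgeFactor_mk _ _ h]
  obtain ⟨l, rfl⟩ := Fin.exists_succ_eq.2 (Fin.ne_zero_of_lt h)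
  refine Fin.cases ?_ (fun k => ?_) k
  · simp only [xVar, yVar, Fin.cons_zero, Fin.cons_succ, map_sub, map_mul, actPoly,
      MvPolynomial.aeval_X, MvPolynomial.algHom_C, MvPolynomial.algebraMap_eq, Fin.sum_univ_two,
      map_neg, map_add]
    ring
  · have hdet : (MvPolynomial.C (g 0 0) * MvPolynomial.C (g 1 1) -
        MvPolynomial.C (g 0 1) * MvPolynomial.C (g 1 0) : MvPolynomial (Fin m × Fin 2) f) = 1 := by
      rw [← map_mul, ← map_mul, ← map_sub, ← Matrix.det_fin_two, g.det_coe, map_one]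
    simp only [xVar, yVar, Fin.cons_succ, map_sub, map_mul, actPoly,
      MvPolynomial.aeval_X, Fin.sum_univ_two]
    linear_combination (MvPolynomial.X (k, 0) * MvPolynomial.X (l, 1) -
      MvPolynomial.X (l, 0) * MvPolynomial.X (k, 1)) * hdet

/-- The expansion of `P_G` over the orientations of `G`. -/
theorem prod_edgeFactor (G : Multigraph m) (α β : f) :
    ∏ e : G.Edge, edgeFactor α β e.1 =
      ∑ g : G.Orientation, ∏ e : G.Edge, arrowTerm α β (g.1 e) := by
  simp only [edgeFactor]
  rw [Finset.prod_univ_sum]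
  refine Finset.sum_bij' (fun x hx => ⟨x, fun e => by
      have := Fintype.mem_piFinset.1 hx e
      simpa using this⟩) (fun g _ => g.1) ?_ ?_ ?_ ?_ ?_
  · intros
    exact Finset.mem_univ _
  · intro g _
    rw [Fintype.mem_piFinset]
    intro e
    simpa using g.2 e
  · intros
    rfl
  · intros
    rfl
  · intros
    rfl

theorem prod_arrowTerm (G : OuterplanarGraph d) (α β : f) (g : G.1.Orientation) :
    ∏ e : G.1.Edge, arrowTerm α β (g.1 e) =
      MvPolynomial.C ((-1) ^ Multigraph.inv g *
        ((-α) ^ Multigraph.inDeg g 0 * β ^ Multigraph.outDeg g 0)) * toPoly f d (G.b f g) := by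
  have hx : ∏ e, xVar m β (g.1 e).1 = ∏ k, xVar m β k ^ Multigraph.outDeg g k := by
    rw [← Finset.prod_fiberwise' Finset.univ (fun e => (g.1 e).1)]
    refine Finset.prod_congr rfl fun k _ => ?_
    rw [Finset.prod_const, Multigraph.outDeg]
  have hy : ∏ e, yVar m α (g.1 e).2 = ∏ k, yVar m α k ^ Multigraph.inDeg g k := by
    rw [← Finset.prod_fiberwise' Finset.univ (fun e => (g.1 e).2)]
    refine Finset.prod_congr rfl fun k _ => ?_
    rw [Finset.prod_const, Multigraph.inDeg]
  have hs : ∏ e, (-1 : MvPolynomial (Fin m × Fin 2) f) ^ (if (g.1 e).2 < (g.1 e).1 then 1 else 0) =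
      (-1) ^ Multigraph.inv g := by
    rw [Finset.prod_pow_eq_pow_sum, Multigraph.inv, Finset.card_filter]
  simp only [arrowTerm]
  rw [Finset.prod_mul_distrib, Finset.prod_mul_distrib, hx, hy, hs, Fin.prod_univ_succ,
    Fin.prod_univ_succ, OuterplanarGraph.b, toPoly_tprod_xy]
  simp only [xVar, yVar, Fin.cons_zero, Fin.cons_succ, map_mul, map_pow, map_neg, map_one]
  ring

namespace OuterplanarGraph

variable (G : OuterplanarGraph d)

theorem inDeg_zero_le (g : G.1.Orientation) : Multigraph.inDeg g 0 < G.deg0 + 1 := by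
  have := Multigraph.outDeg_add_inDeg g 0
  rw [deg0]
  omega

/-- The value at `x_0 = β`, `y_0 = -α` of the form in `x_0`, `y_0` with coefficients
`t_{G,i}`. -/
def genT (α β : f) : TensorSpace f d :=
  ∑ i : Fin (G.deg0 + 1), ((-α) ^ (i : ℕ) * β ^ (G.deg0 - i)) • G.t f i

theorem toPoly_genT (α β : f) :
    toPoly f d (G.genT α β) = ∏ e : G.1.Edge, edgeFactor α β e.1 := by
  rw [prod_edgeFactor, genT, map_sum]
  simp only [prod_arrowTerm, t, map_smul, map_sum]
  let φ : G.1.Orientation → Fin (G.deg0 + 1) := fun g =>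
    ⟨Multigraph.inDeg g 0, G.inDeg_zero_le g⟩
  rw [← Finset.sum_fiberwise Finset.univ φ]
  refine Finset.sum_congr rfl fun i _ => ?_
  rw [Finset.smul_sum]
  refine Finset.sum_congr (by ext g; simp [φ, Fin.ext_iff]) fun g hg => ?_
  have h1 : Multigraph.inDeg g 0 = i := by
    have := (Finset.mem_filter.1 hg).2
    simpa [φ, Fin.ext_iff] using this
  have h2 : Multigraph.outDeg g 0 = G.deg0 - i := by
    have := Multigraph.outDeg_add_inDeg g 0
    change _ = G.1.degree 0 - (i : ℕ)
    omega
  rw [h1, h2, MvPolynomial.C_mul', smul_smul, mul_comm]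

theorem rhoTensor_genT (g : Matrix.SpecialLinearGroup (Fin 2) f) (α β : f) :
    rhoTensor f d g (G.genT α β) =
      G.genT (α * g 0 0 + β * g 0 1) (α * g 1 0 + β * g 1 1) := by
  apply toPoly_injective
  rw [toPoly_rhoTensor, toPoly_genT, toPoly_genT, map_prod]
  refine Finset.prod_congr rfl fun e _ => ?_
  rw [Multigraph.Edge.eq_mk e, actPoly_edgeFactor g α β (Multigraph.Edge.inf_lt_sup e)]

/-- The linear map `s_G` from `S^{d₀} V` to the tensor product. -/
def sMap (f : Type*) [Field f] : SymPow f G.deg0 →ₗ[f] TensorSpace f d :=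
  (symBasis f G.deg0).constr f fun i =>
    ((-1 : f) ^ (i : ℕ) / (G.deg0.choose i : f)) • G.t f i

theorem sMap_xy (i j : ℕ) (h : i + j = G.deg0) :
    G.sMap f (xy f i j h) = ((-1 : f) ^ i / (G.deg0.choose i : f)) • G.t f i := by
  obtain rfl : j = G.deg0 - i := by omega
  have := (symBasis f G.deg0).constr_basis f (fun i : Fin (G.deg0 + 1) =>
    ((-1 : f) ^ (i : ℕ) / (G.deg0.choose i : f)) • G.t f i) ⟨i, by omega⟩
  rw [symBasis_apply] at this
  exact this

variable [CharZero f]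

theorem choose_ne_zero {k i : ℕ} (h : i ≤ k) : (k.choose i : f) ≠ 0 :=
  Nat.cast_ne_zero.2 (Nat.choose_pos h).ne'

/-- `s_G` sends the power `(α x + β y)^{d₀}` to the tensor whose polynomial is the product of the
`x_k y_l - x_l y_k` over the edges not ending in `0` and of the `α x_k + β y_k` over the edges
between `0` and `k`. -/
theorem sMap_linPow (α β : f) : G.sMap f (linPow G.deg0 α β) = G.genT α β := by
  rw [linPow_eq_sum, map_sum, genT]
  refine Finset.sum_congr rfl fun i _ => ?_
  rw [map_smul, sMap_xy, smul_smul]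
  congr 1
  have := choose_ne_zero (f := f) (show (i : ℕ) ≤ G.deg0 by omega)
  rw [neg_pow α]
  field_simp

theorem rhoTensor_sMap (g : Matrix.SpecialLinearGroup (Fin 2) f) (p : SymPow f G.deg0) :
    rhoTensor f d g (G.sMap f p) = G.sMap f (rho f G.deg0 g p) := by
  have : rhoTensor f d g ∘ₗ G.sMap f = G.sMap f ∘ₗ rho f G.deg0 g := by
    apply LinearMap.ext_on_range (span_linPow_eq_top (f := f) G.deg0)
    intro α
    simp only [LinearMap.comp_apply, sMap_linPow, rho_linPow, rhoTensor_genT]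
  exact LinearMap.congr_fun this p

theorem t_eq_smul_sMap {i j : ℕ} (h : i + j = G.deg0) :
    G.t f i = ((-1 : f) ^ i * (G.deg0.choose i : f)) • G.sMap f (xy f i j h) := by
  rw [sMap_xy, smul_smul]
  have := choose_ne_zero (f := f) (show i ≤ G.deg0 by omega)
  rw [mul_div_assoc', mul_right_comm, ← mul_pow]
  simp [this]

theorem range_sMap : LinearMap.range (G.sMap f) = G.T f := by
  rw [sMap, Module.Basis.constr_range, T]
  apply le_antisymm
  · rw [Submodule.span_le]
    rintro _ ⟨i, rfl⟩
    exact Submodule.smul_mem _ _ (Submodule.subset_span ⟨i, rfl⟩)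
  · rw [Submodule.span_le]
    rintro _ ⟨i, rfl⟩
    rw [SetLike.mem_coe]
    have hi := add_sub_cancel_fin i
    beta_reduce
    rw [t_eq_smul_sMap G hi, sMap_xy]
    exact Submodule.smul_mem _ _ (Submodule.subset_span ⟨i, rfl⟩)

theorem rhoTensor_mem_T (g : Matrix.SpecialLinearGroup (Fin 2) f) {v : TensorSpace f d}
    (hv : v ∈ G.T f) : rhoTensor f d g v ∈ G.T f := by
  rw [← range_sMap] at hv ⊢
  obtain ⟨p, rfl⟩ := hv
  exact ⟨_, (G.rhoTensor_sMap g p).symm⟩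

end OuterplanarGraph

end Equivariance

/-! ### Linear independence -/

section LinearAlgebra

variable {f : Type*} [Field f] {W : Type*} [AddCommGroup W] [Module f W] {ι : Type*}

theorem linearIndependent_of_triangular (v : ι → W) (level : ι → ℕ) (φ : ι → W →ₗ[f] f)
    (h1 : ∀ i, φ i (v i) = 1) (h0 : ∀ i j, level i ≤ level j → j ≠ i → φ i (v j) = 0) :
    LinearIndependent f v := by
  classical
  rw [linearIndependent_iff']
  intro s c hc
  by_contra! hne
  obtain ⟨i₀, hi₀, hi₀'⟩ := hne
  obtain ⟨i, hi, hmin⟩ := Finset.exists_min_image (s.filter fun i => c i ≠ 0) level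
    ⟨i₀, Finset.mem_filter.2 ⟨hi₀, hi₀'⟩⟩
  rw [Finset.mem_filter] at hi
  have h := congrArg (φ i) hc
  rw [map_sum, Finset.sum_eq_single i] at h
  · rw [map_smul, h1] at h
    apply hi.2
    simpa using h
  · intro j hj hne
    rw [map_smul]
    by_cases hcj : c j = 0
    · rw [hcj, zero_smul]
    · rw [h0 i j (hmin j (Finset.mem_filter.2 ⟨hj, hcj⟩)) hne, smul_zero]
  · exact fun h => absurd hi.1 h

/-- Let `U τ` act on the vectors `v p` by polynomials in `τ` of degree `deg p` with leading
coefficient proportional to `h p`, where the `h p` with fixed `deg p` are linearly independent.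
Then a combination of the `v p` fixed by all `U τ` involves only the `v p` with `deg p = 0`: if `N`
is the largest degree in it, then the coefficient of `τ^N` in its image is the combination of the
`h p` with, up to nonzero factors, the same coefficients as the `v p` of degree `N` in it. -/
theorem deg_eq_zero_of_unipotent_fixed [Infinite f] {v h : ι → W} {deg : ι → ℕ}
    (U : f → W →ₗ[f] W) (hU : ∀ p, ∃ V : ℕ → W,
      (∀ N, deg p ≤ N → ∀ τ, U τ (v p) = ∑ n ∈ Finset.range (N + 1), τ ^ n • V n) ∧
      (∃ κ : f, κ ≠ 0 ∧ V (deg p) = κ • h p) ∧ ∀ n, deg p < n → V n = 0)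
    (hli : ∀ N, LinearIndepOn f h {p | deg p = N}) (c : ι →₀ f)
    (hc : ∀ τ, U τ (Finsupp.linearCombination f v c) = Finsupp.linearCombination f v c)
    (p : ι) (hp : p ∈ c.support) : deg p = 0 := by
  set w := Finsupp.linearCombination f v c with hw
  by_contra hp0
  set N := c.support.sup deg with hN
  have hle : ∀ q ∈ c.support, deg q ≤ N := fun q hq => Finset.le_sup hq
  have hN0 : N ≠ 0 := by
    have := hle p hp
    omega
  obtain ⟨q, hq, hqN⟩ := Finset.exists_mem_eq_sup c.support ⟨p, hp⟩ deg
  choose V hV hV1 hV0 using hU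
  choose κ hκ hVκ using hV1
  have hcoef : ∀ τ : f, ∑ n ∈ Finset.range (N + 1), τ ^ n •
      ((∑ p ∈ c.support, c p • V p n) - if n = 0 then w else 0) = 0 := by
    intro τ
    have h1 := hc τ
    nth_rw 1 [hw] at h1
    rw [Finsupp.linearCombination_apply, Finsupp.sum, map_sum] at h1
    have h2 : ∀ p ∈ c.support, U τ (c p • v p) =
        ∑ n ∈ Finset.range (N + 1), τ ^ n • c p • V p n := by
      intro p hp
      rw [map_smul, hV p N (hle p hp) τ, Finset.smul_sum]
      exact Finset.sum_congr rfl fun n _ => smul_comm _ _ _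
    rw [Finset.sum_congr rfl h2, Finset.sum_comm] at h1
    simp only [smul_sub, Finset.sum_sub_distrib, Finset.smul_sum]
    rw [h1, sub_eq_zero]
    simp
  have hSN := eq_zero_of_forall_sum_pow_smul_eq_zero hcoef (Nat.lt_succ_self N)
  rw [if_neg hN0, sub_zero,
    ← Finset.sum_filter_add_sum_filter_not _ (fun p => deg p = N)] at hSN
  have hz : ∑ p ∈ c.support with ¬deg p = N, c p • V p N = 0 := by
    refine Finset.sum_eq_zero fun p hp => ?_
    rw [Finset.mem_filter] at hp
    rw [hV0 p N (lt_of_le_of_ne (hle p hp.1) hp.2), smul_zero]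
  have hs : ∑ p ∈ c.support with deg p = N, c p • V p N =
      ∑ p ∈ c.support with deg p = N, (c p * κ p) • h p := by
    refine Finset.sum_congr rfl fun p hp => ?_
    rw [Finset.mem_filter] at hp
    rw [← smul_smul, ← hVκ p, hp.2]
  rw [hz, add_zero, hs] at hSN
  have := linearIndepOn_iff'.1 (hli N) _ _ (by
    intro p hp
    exact (Finset.mem_filter.1 hp).2) hSN q (Finset.mem_filter.2 ⟨hq, hqN.symm⟩)
  exact (mul_ne_zero (Finsupp.mem_support_iff.1 hq) (hκ q)) this

theorem linearIndependent_of_unipotent [Infinite f] {v h : ι → W} {deg : ι → ℕ}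
    (U : f → W →ₗ[f] W) (hU : ∀ p, ∃ V : ℕ → W,
      (∀ N, deg p ≤ N → ∀ τ, U τ (v p) = ∑ n ∈ Finset.range (N + 1), τ ^ n • V n) ∧
      (∃ κ : f, κ ≠ 0 ∧ V (deg p) = κ • h p) ∧ ∀ n, deg p < n → V n = 0)
    (hli : ∀ N, LinearIndepOn f h {p | deg p = N}) (hv : ∀ p, deg p = 0 → v p = h p) :
    LinearIndependent f v := by
  rw [linearIndependent_iff]
  intro c hc
  have h0 := deg_eq_zero_of_unipotent_fixed U hU hli c (fun τ => by rw [hc, map_zero])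
  rw [Finsupp.linearCombination_apply, Finsupp.sum,
    Finset.sum_congr rfl fun p hp => by rw [hv p (h0 p hp)]] at hc
  ext p
  by_contra hp
  exact hp (linearIndepOn_iff'.1 (hli 0) _ _ (fun p hp => h0 p hp) hc p
    (Finsupp.mem_support_iff.2 hp))

/-- The terms of an eigenvector of an operator that acts on the linearly independent vectors `v p`
by scalars all belong to its eigenvalue. -/
theorem eigenvalue_eq_of_mem_support {v : ι → W} (hv : LinearIndependent f v) (c : ι →₀ f)
    (a : ι → f) (r : f)
    (h : ∑ p ∈ c.support, (c p * a p) • v p = r • ∑ p ∈ c.support, c p • v p) :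
    ∀ p ∈ c.support, a p = r := by
  intro p hp
  have hrel : ∑ p ∈ c.support, (c p * a p - r * c p) • v p = 0 := by
    simp only [sub_smul, Finset.sum_sub_distrib]
    rw [h, sub_eq_zero, Finset.smul_sum]
    simp only [smul_smul]
  have h2 := linearIndependent_iff'.1 hv c.support _ hrel p hp
  have h3 : c p * (a p - r) = 0 := by
    rw [← h2]
    ring
  exact sub_eq_zero.1 ((mul_eq_zero.1 h3).resolve_left (Finsupp.mem_support_iff.1 hp))

theorem injective_of_finrank_range_eq {U : Type*} [AddCommGroup U] [Module f U]
    [Module.Finite f U] (φ : U →ₗ[f] W)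
    (h : Module.finrank f (LinearMap.range φ) = Module.finrank f U) : Function.Injective φ := by
  have h1 := LinearMap.finrank_range_add_finrank_ker φ
  rw [← LinearMap.ker_eq_bot]
  exact Submodule.finrank_eq_zero.1 (by omega)

theorem isInternal_span_of_linearIndependent {κ : Type*} [DecidableEq κ] {n : κ → Type*}
    {v : (Σ k, n k) → W} (hv : LinearIndependent f v)
    (hspan : Submodule.span f (Set.range v) = ⊤) :
    DirectSum.IsInternal fun k => Submodule.span f (Set.range fun i => v ⟨k, i⟩) := by
  have hT : ∀ k, Submodule.span f (Set.range fun i => v ⟨k, i⟩) =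
      Submodule.span f (v '' {p | p.1 = k}) := by
    intro k
    congr 1
    ext w
    constructor
    · rintro ⟨i, rfl⟩
      exact ⟨⟨k, i⟩, rfl, rfl⟩
    · rintro ⟨⟨k', i⟩, rfl, rfl⟩
      exact ⟨i, rfl⟩
  apply DirectSum.isInternal_submodule_of_iSupIndep_of_iSup_eq_top
  · rw [iSupIndep_def]
    intro k
    have hle : ⨆ k', ⨆ (_ : k' ≠ k), Submodule.span f (Set.range fun i => v ⟨k', i⟩) ≤
        Submodule.span f (v '' {p | p.1 ≠ k}) := by
      refine iSup₂_le fun k' hk' => ?_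
      rw [hT]
      refine Submodule.span_mono (Set.image_mono ?_)
      rintro p rfl
      exact hk'
    refine Disjoint.mono_right hle ?_
    rw [hT]
    apply hv.disjoint_span_image
    rw [Set.disjoint_left]
    exact fun p hp hp' => hp' hp
  · rw [eq_top_iff, ← hspan, Submodule.span_le]
    rintro _ ⟨⟨k, i⟩, rfl⟩
    exact Submodule.mem_iSup_of_mem k (Submodule.subset_span ⟨i, rfl⟩)

theorem span_eq_top_of_injective {κ : Type*} [Fintype κ] (b : Module.Basis κ f W) {v : ι → W}
    (hv : LinearIndependent f v) {R : κ → ι} (hR : Function.Injective R) :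
    Submodule.span f (Set.range v) = ⊤ := by
  have : Module.Finite f W := Module.Finite.of_basis b
  have := hv.finite
  have := Fintype.ofFinite ι
  apply hv.span_eq_top_of_card_eq_finrank'
  apply le_antisymm hv.fintype_card_le_finrank
  rw [Module.finrank_eq_card_basis b]
  exact Fintype.card_le_of_injective R hR

end LinearAlgebra

namespace Multigraph

variable {m : ℕ} {G : Multigraph m}

/-- The orientation of all edges from left to right. -/
def rightOrientation (G : Multigraph m) : G.Orientation :=
  ⟨fun e => (e.1.inf, e.1.sup), fun e => (Edge.eq_mk e).symm⟩

theorem outDeg_rightOrientation (k : Fin (m + 1)) :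
    outDeg G.rightOrientation k = G.rightDeg k :=
  rfl

theorem inDeg_rightOrientation_zero : inDeg G.rightOrientation 0 = 0 := by
  rw [inDeg, Finset.card_eq_zero, Finset.filter_eq_empty_iff]
  intro e _
  exact Fin.ne_zero_of_lt (Edge.inf_lt_sup e)

theorem inv_rightOrientation : inv G.rightOrientation = 0 := by
  rw [inv, Finset.card_eq_zero, Finset.filter_eq_empty_iff]
  intro e _
  exact (Edge.inf_lt_sup e).not_gt

theorem rightDeg_le_degree (G : Multigraph m) (k : Fin (m + 1)) : G.rightDeg k ≤ G.degree k := by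
  rw [degree_eq_rightDeg_add]
  exact Nat.le_add_right _ _

theorem sum_source (g : G.Orientation) :
    ∑ e, ((g.1 e).1 : ℕ) = ∑ k : Fin m, (k + 1) * outDeg g k.succ := by
  rw [← Finset.sum_fiberwise' Finset.univ (fun e => (g.1 e).1) (fun k : Fin (m + 1) => (k : ℕ)),
    Fin.sum_univ_succ]
  simp only [Finset.sum_const, outDeg, smul_eq_mul, Fin.val_zero, mul_zero, zero_add,
    Fin.val_succ]
  exact Finset.sum_congr rfl fun k _ => mul_comm _ _

/-- The sum of the sources of the arrows is minimal only for the orientation to the right. -/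
theorem eq_rightOrientation_of_sum_le (g : G.Orientation)
    (h : ∑ e, ((g.1 e).1 : ℕ) ≤ ∑ e, ((G.rightOrientation.1 e).1 : ℕ)) :
    g = G.rightOrientation := by
  have hle : ∀ e ∈ Finset.univ, ((G.rightOrientation.1 e).1 : ℕ) ≤ ((g.1 e).1 : ℕ) := by
    intro e _
    have h1 : G.rightOrientation.1 e = (e.1.inf, e.1.sup) := rfl
    rw [h1, ← g.2 e, Sym2.inf_mk]
    exact (inf_le_left : (g.1 e).1 ⊓ (g.1 e).2 ≤ (g.1 e).1)
  have heq := (Finset.sum_eq_sum_iff_of_le hle).1 (le_antisymm (Finset.sum_le_sum hle) h)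
  apply Subtype.ext
  funext e
  have h1 : (G.rightOrientation.1 e).1 = (g.1 e).1 := Fin.ext (heq e (Finset.mem_univ _))
  have h2 := (g.2 e).trans (G.rightOrientation.2 e).symm
  rw [h1] at h2
  exact Prod.ext h1.symm (Sym2.congr_right.1 h2)

end Multigraph

section Independence

variable {f : Type*} [Field f] {m : ℕ} {d : Fin m → ℕ}

namespace OuterplanarGraph

theorem isNonCrossing (G : OuterplanarGraph d) : G.1.IsNonCrossing :=
  G.2.1.isNonCrossing

/-- The `x`-exponents of the monomial belonging to the orientation of `G` to the right. -/
def word (G : OuterplanarGraph d) (k : Fin m) : Fin (d k + 1) :=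
  ⟨G.1.rightDeg k.succ, Nat.lt_succ_of_le ((G.1.rightDeg_le_degree _).trans (G.2.2 k).le)⟩

theorem eq_of_rightDeg_eq {G G' : OuterplanarGraph d}
    (h : ∀ k : Fin m, G.1.rightDeg k.succ = G'.1.rightDeg k.succ) : G = G' :=
  Subtype.ext (G.isNonCrossing.eq_of_rightDeg_eq G'.isNonCrossing
    (fun k => (G.2.2 k).trans (G'.2.2 k).symm) h)

theorem repr_b (G : OuterplanarGraph d) (g : G.1.Orientation) (p : Π k, Fin (d k + 1)) :
    (tensorBasis f d).repr (G.b f g) p =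
      if ∀ k, (p k : ℕ) = Multigraph.outDeg g k.succ then 1 else 0 :=
  tensorBasis_repr_tprod_xy _ p

/-- The weight that makes the orientation to the right give the leading term of `t_{G,0}`. -/
def level (G : OuterplanarGraph d) : ℕ := ∑ e, ((G.1.rightOrientation.1 e).1 : ℕ)

/-- The leading monomial of `t_{G,0}` does not occur in the other `t_{G',0}` of the same or a higher
level, and it occurs in `t_{G,0}` for only one orientation. -/
theorem eq_rightOrientation_of_word {G G' : OuterplanarGraph d} (g : G'.1.Orientation)
    (hl : G.level ≤ G'.level) (h : ∀ k, (G.word k : ℕ) = Multigraph.outDeg g k.succ) :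
    G = G' ∧ g = G'.1.rightOrientation := by
  have hg : g = G'.1.rightOrientation := by
    apply Multigraph.eq_rightOrientation_of_sum_le
    refine le_trans (le_of_eq ?_) hl
    rw [level, Multigraph.sum_source, Multigraph.sum_source]
    refine Finset.sum_congr rfl fun k _ => ?_
    rw [← h k, Multigraph.outDeg_rightOrientation]
    rfl
  refine ⟨eq_of_rightDeg_eq fun k => ?_, hg⟩
  rw [← Multigraph.outDeg_rightOrientation (G := G'.1), ← hg, ← h k]
  rfl

theorem repr_t_zero_of_ne {G G' : OuterplanarGraph d} (hl : G.level ≤ G'.level) (hne : G' ≠ G) :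
    (tensorBasis f d).repr (G'.t f 0) G.word = 0 := by
  rw [t, map_sum, Finsupp.finsetSum_apply]
  refine Finset.sum_eq_zero fun g _ => ?_
  rw [map_smul, Finsupp.smul_apply, repr_b, if_neg, smul_zero]
  exact fun h => hne (eq_rightOrientation_of_word g hl h).1.symm

theorem repr_t_zero_self (G : OuterplanarGraph d) :
    (tensorBasis f d).repr (G.t f 0) G.word = 1 := by
  have hw : ∀ k, (G.word k : ℕ) = Multigraph.outDeg G.1.rightOrientation k.succ := fun _ => rfl
  rw [t, map_sum, Finsupp.finsetSum_apply,
    Finset.sum_eq_single (Multigraph.rightOrientation G.1)]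
  · rw [map_smul, Finsupp.smul_apply, repr_b, if_pos hw,
      Multigraph.inv_rightOrientation, pow_zero, smul_eq_mul, mul_one]
  · intro g _ hg
    rw [map_smul, Finsupp.smul_apply, repr_b, if_neg, smul_zero]
    exact fun h => hg (eq_rightOrientation_of_word g le_rfl h).2
  · intro h
    exact absurd (by simp [Multigraph.inDeg_rightOrientation_zero]) h

theorem linearIndependent_t_zero :
    LinearIndependent f fun G : OuterplanarGraph d => G.t f 0 :=
  linearIndependent_of_triangular (fun G : OuterplanarGraph d => G.t f 0) level
    (fun G => (tensorBasis f d).coord G.word) (fun G => G.repr_t_zero_self)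
    fun _ _ hl hne => repr_t_zero_of_ne hl hne

theorem linearIndepOn_t_zero (N : ℕ) :
    LinearIndepOn f (fun p : Σ G : OuterplanarGraph d, Fin (G.deg0 + 1) => p.1.t f 0)
      {p | (p.2 : ℕ) = N} := by
  have hinj : Function.Injective
      fun p : {p : Σ G : OuterplanarGraph d, Fin (G.deg0 + 1) | (p.2 : ℕ) = N} => p.1.1 := by
    rintro ⟨⟨G, i⟩, hi⟩ ⟨⟨G', i'⟩, hi'⟩ h
    obtain rfl : G = G' := h
    obtain rfl : i = i' := Fin.ext (hi.trans hi'.symm)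
    rfl
  exact (linearIndependent_t_zero (f := f) (d := d)).comp _ hinj

end OuterplanarGraph

/-! ### Vectors fixed by the unipotent subgroup, and the basis of the tensor product -/

/-- The element `x ↦ x + τ y`, `y ↦ y` of `SL(2)`. -/
def unip (τ : f) : Matrix.SpecialLinearGroup (Fin 2) f :=
  ⟨!![1, 0; τ, 1], by simp [Matrix.det_fin_two]⟩

theorem coe_rho_unip_xy {k i j : ℕ} (h : i + j = k) (τ : f) :
    (rho f k (unip τ) (xy f i j h) : MvPolynomial (Fin 2) f) =
      (MvPolynomial.C τ * MvPolynomial.X 1 + MvPolynomial.X 0) ^ i * MvPolynomial.X 1 ^ j := by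
  change changeVars (!![1, 0; τ, 1] : Matrix (Fin 2) (Fin 2) f) (xy f i j h).1 = _
  rw [xy, changeVars, map_mul, map_pow, map_pow, MvPolynomial.aeval_X, MvPolynomial.aeval_X]
  simp [Fin.sum_univ_two, add_comm]

/-- The action of `x ↦ x + τ y` on a monomial of degree `i` in `x` is polynomial of degree `i` in
`τ`, with leading coefficient `y^k`. -/
theorem exists_rho_unip_xy {k i j : ℕ} (h : i + j = k) :
    ∃ v : ℕ → SymPow f k, (∀ N, i ≤ N → ∀ τ : f,
      rho f k (unip τ) (xy f i j h) = ∑ n ∈ Finset.range (N + 1), τ ^ n • v n) ∧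
      v i = xy f 0 k (zero_add k) ∧ ∀ n, i < n → v n = 0 := by
  let v : ℕ → SymPow f k := fun n =>
    if hn : n ≤ i then (i.choose n : f) • xy f (i - n) (j + n) (by omega) else 0
  have hv0 : ∀ n, i < n → v n = 0 := fun n hn => dif_neg (by omega)
  have hv1 : ∀ n, n ≤ i → (v n : MvPolynomial (Fin 2) f) = MvPolynomial.C (i.choose n : f) *
      (MvPolynomial.X 0 ^ (i - n) * MvPolynomial.X 1 ^ (j + n)) := fun n hn => by
    simp only [v, dif_pos hn, Submodule.coe_smul, xy, MvPolynomial.smul_eq_C_mul]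
  refine ⟨v, fun N hN τ => ?_, ?_, hv0⟩
  · have hsub : Finset.range (i + 1) ⊆ Finset.range (N + 1) :=
      Finset.range_subset_range.2 (by omega)
    rw [← Finset.sum_subset hsub]
    · ext1
      rw [coe_rho_unip_xy, add_pow, Finset.sum_mul, Submodule.coe_sum]
      refine Finset.sum_congr rfl fun n hn => ?_
      rw [Finset.mem_range] at hn
      rw [Submodule.coe_smul, hv1 n (by omega), MvPolynomial.smul_eq_C_mul, map_pow, map_natCast]
      ring
    · intro n _ hn
      rw [Finset.mem_range] at hn
      rw [hv0 n (by omega), smul_zero]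
  · ext1
    rw [hv1 i le_rfl]
    simp [xy, ← h, add_comm]

namespace OuterplanarGraph

variable [CharZero f]

theorem exists_rhoTensor_unip_t (G : OuterplanarGraph d) {i : ℕ} (hi : i ≤ G.deg0) :
    ∃ V : ℕ → TensorSpace f d, (∀ N, i ≤ N → ∀ τ : f,
      rhoTensor f d (unip τ) (G.t f i) = ∑ n ∈ Finset.range (N + 1), τ ^ n • V n) ∧
      (∃ κ : f, κ ≠ 0 ∧ V i = κ • G.t f 0) ∧ ∀ n, i < n → V n = 0 := by
  have hij : i + (G.deg0 - i) = G.deg0 := by omega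
  obtain ⟨v, hv, hvi, hv0⟩ := exists_rho_unip_xy (f := f) hij
  refine ⟨fun n => ((-1 : f) ^ i * (G.deg0.choose i : f)) • G.sMap f (v n), ?_, ?_, ?_⟩
  · intro N hN τ
    rw [t_eq_smul_sMap G hij, map_smul, rhoTensor_sMap, hv N hN τ, map_sum, Finset.smul_sum]
    refine Finset.sum_congr rfl fun n _ => ?_
    rw [map_smul, smul_comm]
  · refine ⟨(-1 : f) ^ i * (G.deg0.choose i : f), ?_, ?_⟩
    · exact mul_ne_zero (pow_ne_zero _ (by simp)) (choose_ne_zero hi)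
    · beta_reduce
      rw [hvi, sMap_xy]
      simp
  · intro n hn
    beta_reduce
    rw [hv0 n hn, map_zero, smul_zero]

/-- The family of all tensors `t_{G,i}`. -/
def tFamily (f : Type*) [Field f] {m : ℕ} (d : Fin m → ℕ)
    (p : Σ G : OuterplanarGraph d, Fin (G.deg0 + 1)) : TensorSpace f d :=
  p.1.t f p.2

theorem exists_rhoTensor_unip_tFamily (p : Σ G : OuterplanarGraph d, Fin (G.deg0 + 1)) :
    ∃ V : ℕ → TensorSpace f d, (∀ N, (p.2 : ℕ) ≤ N → ∀ τ : f,
      rhoTensor f d (unip τ) (tFamily f d p) = ∑ n ∈ Finset.range (N + 1), τ ^ n • V n) ∧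
      (∃ κ : f, κ ≠ 0 ∧ V p.2 = κ • p.1.t f 0) ∧ ∀ n, (p.2 : ℕ) < n → V n = 0 :=
  exists_rhoTensor_unip_t p.1 (Nat.lt_succ_iff.1 p.2.2)

/-- A combination of the `t_{G,i}` fixed by all `x ↦ x + τ y` involves only the `t_{G,0}`. -/
theorem eq_zero_of_rhoTensor_unip_eq (c : (Σ G : OuterplanarGraph d, Fin (G.deg0 + 1)) →₀ f)
    (h : ∀ τ : f, rhoTensor f d (unip τ) (Finsupp.linearCombination f (tFamily f d) c) =
      Finsupp.linearCombination f (tFamily f d) c)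
    (p : Σ G : OuterplanarGraph d, Fin (G.deg0 + 1)) (hp : p ∈ c.support) : (p.2 : ℕ) = 0 := by
  have := @deg_eq_zero_of_unipotent_fixed f _ (TensorSpace f d) _ _
    (Σ G : OuterplanarGraph d, Fin (G.deg0 + 1)) _ (tFamily f d)
    (fun p => p.1.t f 0) (fun p => (p.2 : ℕ)) (fun τ => rhoTensor f d (unip τ))
    exists_rhoTensor_unip_tFamily (fun N => linearIndepOn_t_zero N)
  exact this c h p hp

theorem linearIndependent_tFamily : LinearIndependent f (tFamily f d) :=
  @linearIndependent_of_unipotent f _ (TensorSpace f d) _ _ _ _ (tFamily f d)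
    (fun p => p.1.t f 0) (fun p => (p.2 : ℕ)) (fun τ => rhoTensor f d (unip τ))
    exists_rhoTensor_unip_tFamily (fun N => linearIndepOn_t_zero N) fun p hp => by rw [tFamily, hp]

/-- There are at least as many pairs `(G, i)` as monomials, by the correspondence of words of
brackets with non-crossing graphs. -/
theorem span_tFamily_eq_top : Submodule.span f (Set.range (tFamily f d)) = ⊤ := by
  have hex : ∀ a : Π k, Fin (d k + 1), ∃ p : Σ G : OuterplanarGraph d, Fin (G.deg0 + 1),
      ∃ u : Fin m → ℕ, p.1.1.HasWord u (fun k => a k) ∧ (p.2 : ℕ) = ∑ k, u k := by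
    intro a
    obtain ⟨G, u, hG, hdeg, hw⟩ := Multigraph.exists_hasWord _ d (fun k => a k)
      (fun k => Nat.lt_succ_iff.1 (a k).2) rfl
    refine ⟨⟨⟨G, hG.isOuterplanar, hdeg⟩, ⟨∑ k, u k, ?_⟩⟩, u, hw, rfl⟩
    change _ < G.degree 0 + 1
    rw [Nat.lt_succ_iff, Multigraph.degree_zero_eq_sum]
    exact Finset.sum_le_sum fun k _ => hw.le k
  choose R u hw hs using hex
  have hR : Function.Injective R := by
    intro a b hab
    have h1 := hw a
    have h2 := hs a
    rw [hab] at h1 h2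
    have := h1.eq_of_sum_eq (hw b) (by rw [← h2, ← hs b])
    funext k
    exact Fin.ext (congrFun this k)
  exact span_eq_top_of_injective (W := TensorSpace f d) (tensorBasis f d)
    linearIndependent_tFamily hR

end OuterplanarGraph

end Independence

/-! ### The isotypic components -/

section Isotypic

variable {f : Type*} [Field f] {m : ℕ} {d : Fin m → ℕ}

/-- The element `x ↦ x`, `y ↦ α x + y` of `SL(2)`. -/
def upperUnip (α : f) : Matrix.SpecialLinearGroup (Fin 2) f :=
  ⟨!![1, α; 0, 1], by simp [Matrix.det_fin_two]⟩

theorem linPow_zero_smul (k : ℕ) (β : f) : linPow k 0 β = β ^ k • linPow k 0 1 := by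
  ext1
  simp [coe_linPow, MvPolynomial.smul_eq_C_mul, mul_pow]

theorem rho_unip_linPow (k : ℕ) (τ : f) : rho f k (unip τ) (linPow k 0 1) = linPow k 0 1 := by
  rw [rho_linPow]
  simp [unip]

theorem rho_upperUnip_linPow (k : ℕ) (α : f) :
    rho f k (upperUnip α) (linPow k 0 1) = linPow k α 1 := by
  rw [rho_linPow]
  simp [upperUnip]

/-- The diagonal element `x ↦ x / 2`, `y ↦ 2 y` of `SL(2)`. -/
def torusTwo (f : Type*) [Field f] [CharZero f] : Matrix.SpecialLinearGroup (Fin 2) f :=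
  ⟨!![2⁻¹, 0; 0, 2], by simp [Matrix.det_fin_two]⟩

theorem rho_torusTwo_linPow [CharZero f] (k : ℕ) :
    rho f k (torusTwo f) (linPow k 0 1) = (2 : f) ^ k • linPow k 0 1 := by
  rw [rho_linPow, ← linPow_zero_smul]
  simp [torusTwo]

namespace OuterplanarGraph

theorem genT_zero (G : OuterplanarGraph d) (β : f) : G.genT 0 β = β ^ G.deg0 • G.t f 0 := by
  rw [genT, Fin.sum_univ_succ, Finset.sum_eq_zero, add_zero]
  · simp
  · intro i _
    rw [neg_zero, Fin.val_succ, zero_pow (Nat.succ_ne_zero _), zero_mul, zero_smul]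

theorem T_le_span {d₀ : ℕ} (G : OuterplanarGraph d) (hG : G.deg0 = d₀) :
    G.T f ≤ Submodule.span f (Set.range
      (fun p : {G : OuterplanarGraph d // G.deg0 = d₀} × Fin (d₀ + 1) => p.1.1.t f p.2)) := by
  subst hG
  rw [T, Submodule.span_le]
  rintro _ ⟨i, rfl⟩
  exact Submodule.subset_span ⟨(⟨G, rfl⟩, i), rfl⟩

theorem t_mem_T (G : OuterplanarGraph d) {i : ℕ} (hi : i ≤ G.deg0) : G.t f i ∈ G.T f :=
  Submodule.subset_span ⟨⟨i, Nat.lt_succ_of_le hi⟩, rfl⟩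

variable [CharZero f]

theorem rhoTensor_torusTwo_t_zero (G : OuterplanarGraph d) :
    rhoTensor f d (torusTwo f) (G.t f 0) = (2 : f) ^ G.deg0 • G.t f 0 := by
  have h1 : G.t f 0 = G.genT 0 1 := by rw [genT_zero, one_pow, one_smul]
  have h2 : rhoTensor f d (torusTwo f) (G.genT 0 1) = G.genT 0 2 := by
    rw [rhoTensor_genT]
    simp [torusTwo]
  rw [← genT_zero, ← h2, h1]

theorem rhoTensor_mem_span {d₀ : ℕ} (g : Matrix.SpecialLinearGroup (Fin 2) f)
    {v : TensorSpace f d} (hv : v ∈ Submodule.span f (Set.range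
      (fun p : {G : OuterplanarGraph d // G.deg0 = d₀} × Fin (d₀ + 1) => p.1.1.t f p.2))) :
    rhoTensor f d g v ∈ Submodule.span f (Set.range
      (fun p : {G : OuterplanarGraph d // G.deg0 = d₀} × Fin (d₀ + 1) => p.1.1.t f p.2)) := by
  refine Submodule.span_induction (p := fun v _ => rhoTensor f d g v ∈ _) ?_ ?_ ?_ ?_ hv
  · rintro _ ⟨⟨⟨G, hG⟩, i⟩, rfl⟩
    exact T_le_span G hG (G.rhoTensor_mem_T g (G.t_mem_T (by omega)))
  · rw [map_zero]
    exact Submodule.zero_mem _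
  · intro v w _ _ hv hw
    rw [map_add]
    exact Submodule.add_mem _ hv hw
  · intro r v _ hv
    rw [map_smul]
    exact Submodule.smul_mem _ r hv

end OuterplanarGraph

variable [CharZero f]

open OuterplanarGraph

/-- An equivariant map carries `y^{d₀}` to a vector fixed by all `x ↦ x + τ y` on which the
diagonal element acts by `2^{d₀}`, hence to a combination of the `t_{G,0}` where the vertex `0`
has degree `d₀` in `G`. -/
theorem map_linPow_mem_span {d₀ : ℕ} (ψ : SymPow f d₀ →ₗ[f] TensorSpace f d)
    (hψ : ∀ g p, rhoTensor f d g (ψ p) = ψ (rho f d₀ g p)) :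
    ψ (linPow d₀ 0 1) ∈ Submodule.span f (Set.range
      (fun p : {G : OuterplanarGraph d // G.deg0 = d₀} × Fin (d₀ + 1) => p.1.1.t f p.2)) := by
  have hw : ψ (linPow d₀ 0 1) ∈ Submodule.span f (Set.range (tFamily f d)) := by
    rw [span_tFamily_eq_top]
    trivial
  obtain ⟨c, hc⟩ := (Finsupp.mem_span_range_iff_exists_finsupp).1 hw
  have h0 := eq_zero_of_rhoTensor_unip_eq c (fun τ => by
    rw [Finsupp.linearCombination_apply, hc, hψ, rho_unip_linPow])
  rw [← hc]
  have ht := hψ (torusTwo f) (linPow d₀ 0 1)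
  rw [rho_torusTwo_linPow, map_smul, ← hc, Finsupp.sum, map_sum] at ht
  have hterm : ∀ p ∈ c.support, rhoTensor f d (torusTwo f) (c p • tFamily f d p) =
      (c p * 2 ^ p.1.deg0) • tFamily f d p := by
    intro p hp
    rw [map_smul, tFamily, h0 p hp, rhoTensor_torusTwo_t_zero, smul_smul]
  have hdeg : ∀ p ∈ c.support, p.1.deg0 = d₀ := by
    intro p hp
    rw [Finset.sum_congr rfl hterm] at ht
    have h3 := @eigenvalue_eq_of_mem_support f _ (TensorSpace f d) _ _
      (Σ G : OuterplanarGraph d, Fin (G.deg0 + 1)) (tFamily f d) linearIndependent_tFamily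
    have h4 := h3 c (fun p => 2 ^ p.1.deg0) (2 ^ d₀) ht p hp
    have h5 : 2 ^ p.1.deg0 = 2 ^ d₀ := by exact_mod_cast h4
    exact Nat.pow_right_injective le_rfl h5
  refine Submodule.sum_mem _ fun p hp => Submodule.smul_mem _ _ ?_
  exact T_le_span p.1 (hdeg p hp) (p.1.t_mem_T (by omega))

/-- The translates `(α x + y)^{d₀}` of `y^{d₀}` span `S^{d₀} V`. -/
theorem range_le_span {d₀ : ℕ} (ψ : SymPow f d₀ →ₗ[f] TensorSpace f d)
    (hψ : ∀ g p, rhoTensor f d g (ψ p) = ψ (rho f d₀ g p)) (p : SymPow f d₀) :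
    ψ p ∈ Submodule.span f (Set.range
      (fun p : {G : OuterplanarGraph d // G.deg0 = d₀} × Fin (d₀ + 1) => p.1.1.t f p.2)) := by
  have hle : Submodule.span f (Set.range fun α : f => linPow d₀ α 1) ≤
      (Submodule.span f (Set.range (fun p : {G : OuterplanarGraph d // G.deg0 = d₀} ×
        Fin (d₀ + 1) => p.1.1.t f p.2))).comap ψ := by
    rw [Submodule.span_le]
    rintro _ ⟨α, rfl⟩
    beta_reduce
    rw [SetLike.mem_coe, Submodule.mem_comap, ← rho_upperUnip_linPow, ← hψ]
    exact rhoTensor_mem_span _ (map_linPow_mem_span ψ hψ)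
  rw [span_linPow_eq_top] at hle
  exact hle (Submodule.mem_top (x := p))

namespace OuterplanarGraph

theorem linearIndependent_t (G : OuterplanarGraph d) :
    LinearIndependent f (fun i : Fin (G.deg0 + 1) => G.t f i) :=
  (linearIndependent_tFamily (f := f) (d := d)).comp (fun i : Fin (G.deg0 + 1) => ⟨G, i⟩)
    fun i j h => by simpa using h

theorem sMap_injective (G : OuterplanarGraph d) : Function.Injective (G.sMap f) := by
  have h1 : Module.finrank f (G.T f) = G.deg0 + 1 := by
    rw [T, finrank_span_eq_card G.linearIndependent_t, Fintype.card_fin]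
  have h2 : Module.finrank f (SymPow f G.deg0) = G.deg0 + 1 := by
    rw [Module.finrank_eq_card_basis (symBasis f G.deg0), Fintype.card_fin]
  have : Module.Finite f (SymPow f G.deg0) := Module.Finite.of_basis (symBasis f G.deg0)
  apply @injective_of_finrank_range_eq f _ (TensorSpace f d) _ _ (SymPow f G.deg0)
  rw [range_sMap, h1, h2]

/-- The subrepresentation `T_G`. -/
def subrep (f : Type*) [Field f] [CharZero f] (G : OuterplanarGraph d) :
    Subrepresentation (rhoTensor f d) :=
  ⟨G.T f, fun g _ hv => G.rhoTensor_mem_T g hv⟩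

theorem sMap_mem_T (G : OuterplanarGraph d) (p : SymPow f G.deg0) : G.sMap f p ∈ G.T f := by
  rw [← range_sMap]
  exact ⟨p, rfl⟩

/-- The isomorphism `s_G` of `ρ_{d₀}` with the subrepresentation `T_G`. -/
def sEquiv (f : Type*) [Field f] [CharZero f] (G : OuterplanarGraph d) :
    (rho f G.deg0).Equiv (G.subrep f).toRepresentation :=
  Representation.Equiv.mk
    (LinearEquiv.ofBijective ((G.sMap f).codRestrict (G.T f) G.sMap_mem_T)
      ⟨fun p q h => G.sMap_injective (congrArg Subtype.val h), fun ⟨v, hv⟩ => by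
        rw [← range_sMap] at hv
        obtain ⟨p, rfl⟩ := hv
        exact ⟨p, rfl⟩⟩)
    fun g => LinearMap.ext fun p => Subtype.ext (G.rhoTensor_sMap g p).symm

end OuterplanarGraph

theorem span_eq_isotypic (d₀ : ℕ) :
    Submodule.span f (Set.range
      (fun p : {G : OuterplanarGraph d // G.deg0 = d₀} × Fin (d₀ + 1) => p.1.1.t f p.2)) =
      isotypic f d d₀ := by
  apply le_antisymm
  · rw [Submodule.span_le]
    rintro _ ⟨⟨⟨G, rfl⟩, i⟩, rfl⟩
    exact (le_iSup (fun U : {U : Subrepresentation (rhoTensor f d) //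
      Nonempty ((rho f G.deg0).Equiv U.toRepresentation)} => U.1.toSubmodule)
      ⟨G.subrep f, ⟨G.sEquiv f⟩⟩) (G.t_mem_T (by omega))
  · refine iSup_le ?_
    rintro ⟨U, ⟨φ⟩⟩ v hv
    have := range_le_span (U.toSubmodule.subtype ∘ₗ φ.toLinearMap) (fun g p => by
      have := Representation.IntertwiningMap.isIntertwining _ _ φ.toIntertwiningMap g p
      exact (congrArg Subtype.val this).symm) (φ.symm ⟨v, hv⟩)
    simpa using this

theorem isInternal_T : DirectSum.IsInternal (fun G : OuterplanarGraph d => G.T f) :=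
  @isInternal_span_of_linearIndependent f _ (TensorSpace f d) _ _ (OuterplanarGraph d) _
    (fun G => Fin (G.deg0 + 1)) (tFamily f d) (linearIndependent_tFamily (f := f) (d := d))
    span_tFamily_eq_top

end Isotypic

end OuterplanarTensor

end

theorem mainTheorem1 (f : Type*) [Field f] [CharZero f] (m : ℕ) (d : Fin m → ℕ) :
    -- for every fixed `d₀` the `t_{G,i}` are a basis of the isotypic component of type `ρ_{d₀}`
    (∀ d₀ : ℕ,
      LinearIndependent f
        (fun p : {G : OuterplanarGraph d // G.deg0 = d₀} × Fin (d₀ + 1) => p.1.1.t f p.2) ∧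
      Submodule.span f (Set.range
        (fun p : {G : OuterplanarGraph d // G.deg0 = d₀} × Fin (d₀ + 1) => p.1.1.t f p.2)) =
        isotypic f d d₀) ∧
    -- each `T_G` has the basis `t_{G,0}, …, t_{G,d₀}`, is invariant, and `s_G` is an isomorphism
    -- of representations from `S^{d₀} V` onto `T_G`
    (∀ G : OuterplanarGraph d,
      LinearIndependent f (fun i : Fin (G.deg0 + 1) => G.t f i) ∧
      ∃ hT : ∀ (g : Matrix.SpecialLinearGroup (Fin 2) f) ⦃v : TensorSpace f d⦄,
          v ∈ G.T f → rhoTensor f d g v ∈ G.T f,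
        ∃ s : (rho f G.deg0).Equiv
            (Subrepresentation.mk (ρ := rhoTensor f d) (G.T f) hT).toRepresentation,
          ∀ (i j : ℕ) (h : i + j = G.deg0),
            (s (xy f i j h) : TensorSpace f d) =
              ((-1 : f) ^ i / (G.deg0.choose i : f)) • G.t f i) ∧
    -- the tensor product is the direct sum of the `T_G`
    DirectSum.IsInternal (fun G : OuterplanarGraph d => G.T f) := by
  refine ⟨fun d₀ => ⟨?_, span_eq_isotypic d₀⟩, fun G => ⟨G.linearIndependent_t,
    (G.subrep f).apply_mem_toSubmodule, G.sEquiv f, G.sMap_xy⟩, isInternal_T⟩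
  let r : {G : OuterplanarGraph d // G.deg0 = d₀} × Fin (d₀ + 1) →
      Σ G : OuterplanarGraph d, Fin (G.deg0 + 1) :=
    fun p => ⟨p.1.1, p.2.cast (by rw [p.1.2])⟩
  have hr : Function.Injective r := by
    rintro ⟨⟨G, rfl⟩, i⟩ ⟨⟨G', hG'⟩, i'⟩ h
    obtain rfl : G = G' := congrArg Sigma.fst h
    simpa [r] using h
  exact (OuterplanarGraph.linearIndependent_tFamily (f := f) (d := d)).comp r hr
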